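/- Let $r\ge 1$, $b\ge 1$, $n\ge 2^{r+1}$ be integers and let $q=2^b$. Identify $\mathbb F_q^n\otimes_{\mathbb F_q}\mathbb F_q^n$ with $\mathbb F_q^{n\times n}$, viewed as a vector space over $\mathbb F_2\subseteq\mathbb F_q$. Let $G\in\mathbb F_2^{(2^{r+1}-1)\times(r+1)}$ be the generator matrix of the Hadamard code: for $1\le k\le 2^{r+1}-1$ its $k$th row is the binary representation of $2^{r+1}-k$, most significant bit first. Let $X=X^{r,b,n}$ be the poset, ordered by inclusion, of all $\mathbb F_2$-subspaces of the $(r+1)$-dimensional $\mathbb F_2$-subspaces of the form $$\operatorname{im}\Big(\big(e^{(1)}_1\otimes e^{(2)}_1\ \cdots\ e^{(1)}_{2^{r+1}-1}\otimes e^{(2)}_{2^{r+1}-1}\big)\,G\Big),$$ where $e^{(1)}_1,\dots,e^{(1)}_{2^{r+1}-1}\in\mathbb F_q^n$ are linearly independent over $\mathbb F_q$, and so are $e^{(2)}_1,\dots,e^{(2)}_{2^{r+1}-1}\in\mathbb F_q^n$. An element has rank $\dim_{\mathbb F_2}-1$, $X(i)$ is the set of elements of rank $i$, and $m_X$ is the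 uniform probability distribution on each $X(i)$. The link of $x\in X$ is the poset $X_x=\{y\in X: x\subseteq y\}$ with $\operatorname{rank}_{X_x}(y)=\operatorname{rank}(y)-\operatorname{rank}(x)-1$ and with the weights $m_X$ renormalized to a probability distribution $m_{X_x}$ on each rank. Its 1-skeleton graph $\mathbf G_{X_x}$ has vertex set $X_x(0)$; distinct vertices $y,y'$ are joined if some $z\in X_x(1)$ has $y,y'\subsetneq z$, and the edge then has weight $\sum_{z\in X_x(1):\,y,y'\subsetneq z}m_{X_x}(z)$. For $A,B\in\mathbb F_q^{m\times m}$ write $A\preceq B$ if $\operatorname{rank}(B-A)=\operatorname{rank}(B)-\operatorname{rank}(A)$, and $A\prec B$ if moreover $A\ne B$. Let $\mathcal M_q^m(s)$ be the set of matrices of rank $s$ in $\mathbb F_q^{m\times m}$. The tensor product of weighted graphs has the product vertex set and the weights $m((u,u'),(v,v'))=m(u,v)\,m(u',v')$; the $0$th tensor power of a graph is a single vertex with a loop of weight $1$. A graph projection $\Pi:\mathbf G'\to\mathbf G$ of weighted graphs is a surjective map $\Pi:V(\mathbf G')\to V(\mathbf G)$ such that for all $v_1,v_2\in V(\mathbf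 G)$ $$m_{\mathbf G}(v_1,v_2)=\sum_{v_1'\in\Pi^{-1}(v_1),\,v_2'\in\Pi^{-1}(v_2)}m_{\mathbf G'}(v_1',v_2'),$$ where $m(v,v')$ is the weight of the edge $\{v,v'\}$, and $0$ if there is no such edge. **Proposition.** Let $-1\le i\le r-2$ and $x_i\in X(i)$, and let $R,C\subseteq\mathbb F_q^n$ be any $(2^{r+1}-2^{r-i})$-dimensional $\mathbb F_q$-subspaces (for example $R=C=\mathbb F_q^{2^{r+1}-2^{r-i}}\times\{0\}^{n-(2^{r+1}-2^{r-i})}$). Let $\mathbf G_1$ be the graph with $$V(\mathbf G_1)=\{M\in\mathcal M_q^{2^{r-i}}(2^{r-i-1}): M\prec I_{2^{r-i}}\},$$ $$E(\mathbf G_1)=\big\{\{L_1+L_2,L_1+L_3\}: L_1,L_2,L_3\in\mathcal M_q^{2^{r-i}}(2^{r-i-2}),\ L_1+L_2+L_3\in\mathcal M_q^{2^{r-i}}(3\cdot2^{r-i-2}),\ L_1+L_2+L_3\prec I_{2^{r-i}}\big\},$$ all of whose edges have the same weight $c_1>0$, and let $\mathbf G_2$ be the graph with $$V(\mathbf G_2)=\{M\in\mathcal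 M_q^{n}(2^{r-i-1}): \operatorname{rowspan}(M)\cap R=\{0\},\ \operatorname{colspan}(M)\cap C=\{0\}\},$$ $$E(\mathbf G_2)=\big\{\{L_1+L_2,L_1+L_3\}: L_1,L_2,L_3\in\mathcal M_q^{n}(2^{r-i-2}),\ L_1+L_2+L_3\in\mathcal M_q^{n}(3\cdot2^{r-i-2}),$$ $$\operatorname{rowspan}(L_1+L_2+L_3)\cap R=\{0\},\ \operatorname{colspan}(L_1+L_2+L_3)\cap C=\{0\}\big\},$$ all of whose edges have the same weight $c_2>0$. Then for every $c_1>0$ there is a normalization $c_2>0$ for which there exists a graph projection $$\Pi:\mathbf G_1^{\otimes(2^{i+1}-1)}\otimes\mathbf G_2\to\mathbf G_{X_{x_i}}.$$ -/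

import Mathlib

open scoped NNReal

noncomputable section

namespace LowRank

universe u v

/-! ## Weighted graphs, tensor products and graph projections -/

/-- An undirected weighted graph `(V, E, m)`, loops allowed. Each undirected edge is seen as a pair
of directed copies, and the weight is extended by zero outside of the edge set. -/
structure WeightedGraph (V : Type u) where
  Adj : V → V → Prop
  adj_symm : ∀ a b, Adj a b → Adj b a
  weight : V → V → ℝ≥0
  weight_symm : ∀ a b, weight a b = weight b a
  weight_eq_zero : ∀ a b, ¬ Adj a b → weight a b = 0

open Classical in
/-- The uniformly weighted graph with the given edges, each of weight `c`. -/
def WeightedGraph.uniform {V : Type u} (Adj : V → V → Prop) (h : ∀ a b, Adj a b → Adj b a)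
    (c : ℝ≥0) : WeightedGraph V where
  Adj := Adj
  adj_symm := h
  weight a b := if Adj a b then c else 0
  weight_symm a b := by
    have hab : Adj a b ↔ Adj b a := ⟨h a b, h b a⟩
    simp only [hab]
  weight_eq_zero a b hab := if_neg hab

/-- The tensor product of two weighted graphs. -/
def WeightedGraph.tensor {V : Type u} {W : Type v} (G : WeightedGraph V) (H : WeightedGraph W) :
    WeightedGraph (V × W) where
  Adj a b := G.Adj a.1 b.1 ∧ H.Adj a.2 b.2
  adj_symm a b h := ⟨G.adj_symm _ _ h.1, H.adj_symm _ _ h.2⟩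
  weight a b := G.weight a.1 b.1 * H.weight a.2 b.2
  weight_symm a b := by rw [G.weight_symm, H.weight_symm]
  weight_eq_zero a b h := by
    by_cases h1 : G.Adj a.1 b.1
    · rw [H.weight_eq_zero _ _ fun h2 => h ⟨h1, h2⟩, mul_zero]
    · rw [G.weight_eq_zero _ _ h1, zero_mul]

/-- The `N`-fold tensor power of a weighted graph. For `N = 0` it is a single vertex with a loop of
weight one, the unit of the tensor product. -/
def WeightedGraph.tensorPow {V : Type u} (G : WeightedGraph V) (N : ℕ) :
    WeightedGraph (Fin N → V) where
  Adj a b := ∀ j, G.Adj (a j) (b j)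
  adj_symm a b h j := G.adj_symm _ _ (h j)
  weight a b := ∏ j, G.weight (a j) (b j)
  weight_symm a b := Finset.prod_congr rfl fun j _ => G.weight_symm _ _
  weight_eq_zero a b h := by
    obtain ⟨j, hj⟩ := not_forall.mp h
    exact Finset.prod_eq_zero (Finset.mem_univ j) (G.weight_eq_zero _ _ hj)

/-- `p` is a graph projection from the finite graph `G'` to the graph `G`. -/
def IsGraphProjection {V' : Type u} {V : Type v} [Finite V'] (G' : WeightedGraph V')
    (G : WeightedGraph V) (p : V' → V) : Prop :=
  Function.Surjective p ∧
    ∀ v₁ v₂ : V, G.weight v₁ v₂ = ∑ᶠ (a ∈ p ⁻¹' {v₁}) (b ∈ p ⁻¹' {v₂}), G'.weight a b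

/-! ## Weighted posets, links and 1-skeleton graphs -/

/-- A rank function and a weight function on a poset. -/
structure RankedWeights (α : Type u) [PartialOrder α] where
  rank : α → ℤ
  weight : α → ℝ≥0

/-- The link of `x`: the poset of all `y ≥ x`, with the rank shifted so that `x` has rank `-1`, and
with the weights renormalized on every rank. -/
def RankedWeights.link {α : Type u} [PartialOrder α] (X : RankedWeights α) (x : α) :
    RankedWeights {y : α // x ≤ y} where
  rank y := X.rank y - X.rank x - 1
  weight y := X.weight y /
    ∑ᶠ (z : {y : α // x ≤ y}) (_ : X.rank (z : α) = X.rank (y : α)), X.weight (z : α)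

open Classical in
/-- The 1-skeleton graph: the vertices are the elements of rank `0`, and the weight of an edge is
the total weight of the elements of rank `1` above both of its ends. -/
def RankedWeights.skeletonGraph {α : Type u} [PartialOrder α] (X : RankedWeights α) :
    WeightedGraph {x : α // X.rank x = 0} where
  Adj x y := x ≠ y ∧ ∃ z : α, X.rank z = 1 ∧ (x : α) < z ∧ (y : α) < z
  adj_symm x y h := ⟨h.1.symm, h.2.imp fun _ hz => ⟨hz.1, hz.2.2, hz.2.1⟩⟩
  weight x y :=
    if x ≠ y ∧ ∃ z : α, X.rank z = 1 ∧ (x : α) < z ∧ (y : α) < z then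
      ∑ᶠ (z : α) (_ : X.rank z = 1 ∧ (x : α) < z ∧ (y : α) < z), X.weight z
    else 0
  weight_symm x y := by
    have h (z : α) : (X.rank z = 1 ∧ (x : α) < z ∧ (y : α) < z) ↔
        (X.rank z = 1 ∧ (y : α) < z ∧ (x : α) < z) :=
      and_congr_right fun _ => and_comm
    simp only [h, ne_comm (a := x) (b := y)]
  weight_eq_zero x y h := if_neg h

/-! ## The Grassmannian poset of low-rank matrices

The space `F ^ n ⊗ F ^ n` is identified with the `n × n` matrices over `F`, the pure tensor of
`e` and `e'` being the matrix `Matrix.vecMulVec e e'`. -/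

/-- The generator matrix of the Hadamard code of length `2 ^ (r + 1) - 1`. With rows counted from
`1`, row `k` is the binary representation of `2 ^ (r + 1) - k`, most significant bit first; here the
rows and columns are counted from `0`. -/
def hadamardGenerator (r : ℕ) : Matrix (Fin (2 ^ (r + 1) - 1)) (Fin (r + 1)) (ZMod 2) :=
  fun k j => if (2 ^ (r + 1) - ((k : ℕ) + 1)).testBit (r - (j : ℕ)) then 1 else 0

variable (F : Type u) [Field F]

/-- The top faces: the `(r + 1)`-dimensional `𝔽₂`-subspaces spanned by the columns of `E * G`,
where `G` is the Hadamard generator matrix and the `k`-th column of `E` is the rank-one matrix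
`e₁ k ⊗ e₂ k`, for two linearly independent families `e₁` and `e₂`. -/
def IsTopFace [Algebra (ZMod 2) F] (r n : ℕ)
    (W : Submodule (ZMod 2) (Matrix (Fin n) (Fin n) F)) : Prop :=
  Module.finrank (ZMod 2) W = r + 1 ∧
    ∃ e₁ e₂ : Fin (2 ^ (r + 1) - 1) → Fin n → F,
      LinearIndependent F e₁ ∧ LinearIndependent F e₂ ∧
      W = Submodule.span (ZMod 2) (Set.range fun j : Fin (r + 1) =>
        ∑ k, hadamardGenerator r k j • Matrix.vecMulVec (e₁ k) (e₂ k))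

/-- The faces: all `𝔽₂`-subspaces of top faces, ordered by inclusion. -/
abbrev Face [Algebra (ZMod 2) F] (r n : ℕ) : Type u :=
  {x : Submodule (ZMod 2) (Matrix (Fin n) (Fin n) F) // ∃ W, IsTopFace F r n W ∧ x ≤ W}

/-- The Grassmannian poset, ranked by dimension minus one, with the uniform probability
distribution on the faces of every rank. -/
def lowRankPoset [Algebra (ZMod 2) F] (r n : ℕ) : RankedWeights (Face F r n) where
  rank x := (Module.finrank (ZMod 2) x.1 : ℤ) - 1
  weight x := 1 / (Nat.card {y : Face F r n //
    Module.finrank (ZMod 2) y.1 = Module.finrank (ZMod 2) x.1} : ℝ≥0)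

/-! ## The matrix poset and the two walks on it -/

variable {F}

/-- `A ⪯ B` in the matrix poset. -/
def RankLE {m : ℕ} (A B : Matrix (Fin m) (Fin m) F) : Prop :=
  ((B - A).rank : ℤ) = (B.rank : ℤ) - (A.rank : ℤ)

/-- `A ≺ B` in the matrix poset. -/
def RankLT {m : ℕ} (A B : Matrix (Fin m) (Fin m) F) : Prop :=
  RankLE A B ∧ A ≠ B

/-- The row span of a matrix. -/
def rowSpan {m : ℕ} (A : Matrix (Fin m) (Fin m) F) : Submodule F (Fin m → F) :=
  Submodule.span F (Set.range A.row)

/-- The column span of a matrix. -/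
def colSpan {m : ℕ} (A : Matrix (Fin m) (Fin m) F) : Submodule F (Fin m → F) :=
  Submodule.span F (Set.range A.col)

variable (F)

/-- The vertices of the first walk, where `s` stands for `r - i - 2`. -/
abbrev Vertex₁ (s : ℕ) : Type u :=
  {M : Matrix (Fin (2 ^ (s + 2))) (Fin (2 ^ (s + 2))) F // M.rank = 2 ^ (s + 1) ∧ RankLT M 1}

/-- The first walk, where `s` stands for `r - i - 2`, with all edges of weight `c`. -/
def walk₁ (s : ℕ) (c : ℝ≥0) : WeightedGraph (Vertex₁ F s) :=
  WeightedGraph.uniform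
    (fun A B => ∃ L₁ L₂ L₃ : Matrix (Fin (2 ^ (s + 2))) (Fin (2 ^ (s + 2))) F,
      L₁.rank = 2 ^ s ∧ L₂.rank = 2 ^ s ∧ L₃.rank = 2 ^ s ∧
      (L₁ + L₂ + L₃).rank = 3 * 2 ^ s ∧ RankLT (L₁ + L₂ + L₃) 1 ∧
      A.1 = L₁ + L₂ ∧ B.1 = L₁ + L₃)
    (by
      rintro A B ⟨L₁, L₂, L₃, h1, h2, h3, h4, h5, hA, hB⟩
      have h : L₁ + L₃ + L₂ = L₁ + L₂ + L₃ := add_right_comm _ _ _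
      exact ⟨L₁, L₃, L₂, h1, h3, h2, by rw [h, h4], by rwa [h], hB, hA⟩)
    c

variable {F}

/-- The vertices of the second walk, where `s` stands for `r - i - 2`. -/
abbrev Vertex₂ (s n : ℕ) (R C : Submodule F (Fin n → F)) : Type u :=
  {M : Matrix (Fin n) (Fin n) F // M.rank = 2 ^ (s + 1) ∧ rowSpan M ⊓ R = ⊥ ∧ colSpan M ⊓ C = ⊥}

/-- The second walk, where `s` stands for `r - i - 2`, with all edges of weight `c`. -/
def walk₂ (s n : ℕ) (R C : Submodule F (Fin n → F)) (c : ℝ≥0) :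
    WeightedGraph (Vertex₂ s n R C) :=
  WeightedGraph.uniform
    (fun A B => ∃ L₁ L₂ L₃ : Matrix (Fin n) (Fin n) F,
      L₁.rank = 2 ^ s ∧ L₂.rank = 2 ^ s ∧ L₃.rank = 2 ^ s ∧
      (L₁ + L₂ + L₃).rank = 3 * 2 ^ s ∧
      rowSpan (L₁ + L₂ + L₃) ⊓ R = ⊥ ∧ colSpan (L₁ + L₂ + L₃) ⊓ C = ⊥ ∧
      A.1 = L₁ + L₂ ∧ B.1 = L₁ + L₃)
    (by
      rintro A B ⟨L₁, L₂, L₃, h1, h2, h3, h4, h5, h6, hA, hB⟩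
      have h : L₁ + L₃ + L₂ = L₁ + L₂ + L₃ := add_right_comm _ _ _
      exact ⟨L₁, L₃, L₂, h1, h3, h2, by rw [h, h4], by rwa [h], by rwa [h], hB, hA⟩)
    c

end LowRank

end

set_option linter.unusedSectionVars false

namespace LowRank

/-! ### Rank additivity and orthogonal families -/

section Rank

open Matrix

variable {F : Type*} [Field F] {m : Type*} [Fintype m] [DecidableEq m]

/-! The rows of the Hadamard matrix are exactly the nonzero vectors of `𝔽₂^(r+1)`. A top face is
therefore the span of vectors `v i = ∑ φ i • E φ`, where the `E φ` form a rank-additive family of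
rank-one matrices indexed by the nonzero functionals `φ`. Restricting functionals to a subspace of
dimension `k` groups these matrices into blocks of rank `2^(r+1-k)`, so every basis of every face
has such a frame (`IsFrame.exists_of_mem_span`). The frame is determined by the basis
(`IsFrame.unique`). Conversely, since `n ≥ 2^(r+1)`, vectors having a frame with blocks of that rank
span a face (`IsFrame.exists_isTopFace`).

Enlarging a face `x` by a vector `m` thus amounts to halving every block `E φ`, `φ ≠ 0`, by some `A
φ`, and choosing a fresh `A 0` independent of all blocks, with `m = ∑ A φ`; by uniqueness `m`
determines `A` (`IsHalf.isFrame`, `IsFrame.isHalf`, `IsHalf.eq_of_sum_eq`). After factoring `E φ = U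
* V` a halving of `E φ` is a vertex of `walk₁`. After a change of coordinates taking the row and
column spans of `∑ E φ` to `R` and `C`, the matrix `A 0` is a vertex of `walk₂`. Enlarging by two
vectors quarters the blocks instead, which gives the edges of both walks (`IsQuarter`).

The projection sends `A` to the span of `x` and `∑ A φ`. Its fibre over `y` corresponds to `y \ x`,
which has `2^k` elements, and it preserves and reflects adjacency. Edge weights are constant on both
sides, because the sum of two adjacent vertices of the link is the only rank-one element above both.
Hence a single choice of `c₂` balances all weights. -/

theorem rank_add_le (A B : Matrix m m F) : (A + B).rank ≤ A.rank + B.rank := by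
  unfold Matrix.rank
  rw [Matrix.mulVecLin_add]
  exact (Submodule.finrank_mono (LinearMap.range_add_le _ _)).trans
    (Submodule.finrank_add_le_finrank_add_finrank _ _)

theorem rank_sum_le {α : Type*} (s : Finset α) (E : α → Matrix m m F) :
    (∑ a ∈ s, E a).rank ≤ ∑ a ∈ s, (E a).rank := by
  classical
  induction s using Finset.induction_on with
  | empty => simp
  | insert a s ha ih =>
    rw [Finset.sum_insert ha, Finset.sum_insert ha]
    exact (rank_add_le _ _).trans (by omega)

theorem exists_eq_mul_of_range_le {A S : Matrix m m F}
    (h : LinearMap.range A.mulVecLin ≤ LinearMap.range S.mulVecLin) :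
    ∃ K : Matrix m m F, A = S * K := by
  have h' (j : m) : ∃ k : m → F, S *ᵥ k = A.col j := by
    have : A.col j ∈ LinearMap.range A.mulVecLin := ⟨Pi.single j 1, by simp⟩
    obtain ⟨k, hk⟩ := h this
    exact ⟨k, by simpa using hk⟩
  choose k hk using h'
  refine ⟨Matrix.of fun a j => k j a, ?_⟩
  ext a j
  have := congrFun (hk j) a
  simpa [Matrix.mul_apply, Matrix.mulVec, dotProduct] using this.symm

/-- The rank normal form `V * S * U` is idempotent; cancelling the outer units shows that `U * V` is
a generalized inverse. -/
theorem exists_mul_mul_eq_self (S : Matrix m m F) : ∃ T : Matrix m m F, S * T * S = S := by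
  obtain ⟨V, U, e, hV, hU, h⟩ := exists_rank_normal_form S
  have hN : (V * S * U) * (V * S * U) = V * S * U := by
    rw [h, Matrix.submatrix_mul_equiv, fromBlocks_multiply]
    simp
  refine ⟨U * V, hV.mul_left_cancel (hU.mul_right_cancel ?_)⟩
  simpa only [Matrix.mul_assoc] using hN

theorem range_le_range_add_of_rank_add {A C : Matrix m m F}
    (h : (A + C).rank = A.rank + C.rank) :
    LinearMap.range A.mulVecLin ≤ LinearMap.range (A + C).mulVecLin ∧
      LinearMap.range A.mulVecLin ⊓ LinearMap.range C.mulVecLin = ⊥ := by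
  unfold Matrix.rank at h
  have h1 : LinearMap.range (A + C).mulVecLin ≤
      LinearMap.range A.mulVecLin ⊔ LinearMap.range C.mulVecLin := by
    rw [Matrix.mulVecLin_add]; exact LinearMap.range_add_le _ _
  have h2 := Submodule.finrank_sup_add_finrank_inf_eq (LinearMap.range A.mulVecLin)
    (LinearMap.range C.mulVecLin)
  have h3 := Submodule.finrank_mono h1
  have h4 := Submodule.eq_of_le_of_finrank_le h1 (by omega)
  refine ⟨h4 ▸ le_sup_left, Submodule.finrank_eq_zero.mp (by omega)⟩

/-- `(A + C) * T` fixes the columns of `A`, so `C * T * A = A * (1 - T * A)` has its columns in both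
column spaces, which meet trivially. -/
theorem orthogonal_left_of_rank_add {A C T : Matrix m m F} (h : (A + C).rank = A.rank + C.rank)
    (hT : (A + C) * T * (A + C) = A + C) : A * T * A = A ∧ C * T * A = 0 := by
  obtain ⟨h1, h2⟩ := range_le_range_add_of_rank_add h
  obtain ⟨K, hK⟩ := exists_eq_mul_of_range_le h1
  have h3 : A * T * A + C * T * A = A := by
    rw [← Matrix.add_mul, ← Matrix.add_mul]
    calc (A + C) * T * A = (A + C) * T * ((A + C) * K) := by rw [← hK]
      _ = A := by rw [← Matrix.mul_assoc, hT, ← hK]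
  have h4 : C * T * A = 0 := by
    ext a j
    have hc : (C * T * A).col j ∈ LinearMap.range A.mulVecLin ⊓ LinearMap.range C.mulVecLin := by
      constructor
      · refine ⟨(1 - T * A).col j, ?_⟩
        rw [← eq_sub_iff_add_eq'] at h3
        rw [h3, Matrix.mulVecLin_apply]
        ext a
        simp [Matrix.mulVec, dotProduct, Matrix.mul_assoc, Matrix.mul_apply,
          mul_sub, Finset.sum_sub_distrib, Matrix.one_apply]
      · refine ⟨(T * A).col j, ?_⟩
        rw [Matrix.mulVecLin_apply]
        ext a
        simp [Matrix.mulVec, dotProduct, Matrix.mul_assoc, Matrix.mul_apply]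
    rw [h2, Submodule.mem_bot] at hc
    exact congrFun hc a
  exact ⟨by rwa [h4, add_zero] at h3, h4⟩

theorem orthogonal_of_rank_add {A C T : Matrix m m F} (h : (A + C).rank = A.rank + C.rank)
    (hT : (A + C) * T * (A + C) = A + C) :
    A * T * A = A ∧ C * T * A = 0 ∧ A * T * C = 0 ∧ C * T * C = C := by
  obtain ⟨h1, h2⟩ := orthogonal_left_of_rank_add h hT
  obtain ⟨h3, h4⟩ := orthogonal_left_of_rank_add (A := C) (C := A) (T := T)
    (by rw [add_comm, h, add_comm]) (by rwa [add_comm])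
  exact ⟨h1, h2, h4, h3⟩

theorem rank_add_of_orthogonal {A C T : Matrix m m F} (hA : A * T * A = A) (hC : C * T * C = C)
    (hAC : A * T * C = 0) (hCA : C * T * A = 0) : (A + C).rank = A.rank + C.rank := by
  refine le_antisymm (rank_add_le _ _) ?_
  have h1 : A = (A + C) * (T * A) := by
    rw [Matrix.add_mul, ← Matrix.mul_assoc, ← Matrix.mul_assoc, hA, hCA, add_zero]
  have h2 : C = (A + C) * (T * C) := by
    rw [Matrix.add_mul, ← Matrix.mul_assoc, ← Matrix.mul_assoc, hC, hAC, zero_add]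
  have hA' : LinearMap.range A.mulVecLin ≤ LinearMap.range (A + C).mulVecLin := by
    conv_lhs => rw [h1, Matrix.mulVecLin_mul]
    exact LinearMap.range_comp_le_range _ _
  have hC' : LinearMap.range C.mulVecLin ≤ LinearMap.range (A + C).mulVecLin := by
    conv_lhs => rw [h2, Matrix.mulVecLin_mul]
    exact LinearMap.range_comp_le_range _ _
  have hdis : LinearMap.range A.mulVecLin ⊓ LinearMap.range C.mulVecLin = ⊥ := by
    rw [Submodule.eq_bot_iff]
    rintro v ⟨⟨u, rfl⟩, ⟨w, hw⟩⟩
    rw [Matrix.mulVecLin_apply] at hw ⊢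
    rw [Matrix.mulVecLin_apply] at hw
    rw [← hA, ← Matrix.mulVec_mulVec, ← hw, Matrix.mulVec_mulVec, hAC, Matrix.zero_mulVec]
  have h3 := Submodule.finrank_sup_add_finrank_inf_eq (LinearMap.range A.mulVecLin)
    (LinearMap.range C.mulVecLin)
  rw [hdis, finrank_bot, add_zero] at h3
  unfold Matrix.rank
  rw [← h3]
  exact Submodule.finrank_mono (sup_le hA' hC')

/-- The matrices `E a * T` are pairwise orthogonal idempotents with the column spaces of `E a`. -/
def IsOrthogonalFamily {α : Type*} [DecidableEq α] (E : α → Matrix m m F) (T : Matrix m m F) : Prop :=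
  ∀ a b, E a * T * E b = if a = b then E a else 0

theorem IsOrthogonalFamily.self {α : Type*} [DecidableEq α] {E : α → Matrix m m F} {T : Matrix m m F}
    (h : IsOrthogonalFamily E T) (a : α) : E a * T * E a = E a := by
  rw [h a a, if_pos rfl]

theorem IsOrthogonalFamily.mul_sum {α : Type*} [DecidableEq α] {E : α → Matrix m m F} {T : Matrix m m F}
    (h : IsOrthogonalFamily E T) (a : α) (s : Finset α) :
    E a * T * ∑ b ∈ s, E b = if a ∈ s then E a else 0 := by
  rw [Matrix.mul_sum, Finset.sum_congr rfl fun b _ => h a b, Finset.sum_ite_eq]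

theorem IsOrthogonalFamily.sum_mul_sum {α : Type*} [DecidableEq α] {E : α → Matrix m m F} {T : Matrix m m F}
    (h : IsOrthogonalFamily E T) (s t : Finset α) :
    (∑ a ∈ s, E a) * T * ∑ b ∈ t, E b = ∑ a ∈ s ∩ t, E a := by
  rw [Matrix.sum_mul, Matrix.sum_mul, Finset.sum_congr rfl fun a _ => h.mul_sum a t,
    Finset.sum_ite_mem]

theorem IsOrthogonalFamily.biUnion {α β : Type*} [DecidableEq α] [DecidableEq β] {E : α → Matrix m m F} {T : Matrix m m F}
    (h : IsOrthogonalFamily E T) (S : β → Finset α) (hS : ∀ b c, b ≠ c → Disjoint (S b) (S c)) :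
    IsOrthogonalFamily (fun b => ∑ a ∈ S b, E a) T := by
  intro b c
  rw [h.sum_mul_sum]
  split_ifs with hbc
  · rw [hbc, Finset.inter_self]
  · rw [Finset.disjoint_iff_inter_eq_empty.mp (hS b c hbc), Finset.sum_empty]

theorem IsOrthogonalFamily.rank_sum {α : Type*} [DecidableEq α] {E : α → Matrix m m F} {T : Matrix m m F}
    (h : IsOrthogonalFamily E T) (s : Finset α) :
    (∑ a ∈ s, E a).rank = ∑ a ∈ s, (E a).rank := by
  induction s using Finset.induction_on with
  | empty => simp
  | insert a s ha ih =>
    have h1 := h.sum_mul_sum {a} s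
    have h2 := h.sum_mul_sum s {a}
    have h3 := h.sum_mul_sum s s
    rw [Finset.singleton_inter_of_notMem ha] at h1
    rw [Finset.inter_singleton_of_notMem ha] at h2
    rw [Finset.inter_self] at h3
    rw [Finset.sum_singleton] at h1 h2
    rw [Finset.sum_insert ha, Finset.sum_insert ha, ← ih]
    exact rank_add_of_orthogonal (h.self a) h3 h1 h2

/-- Any generalized inverse `T` of the total sum works: additivity of rank passes to subsums, so the
two-term case applies to `E a` and the sum of the others. -/
theorem exists_isOrthogonalFamily {α : Type*} [Fintype α] [DecidableEq α] {E : α → Matrix m m F}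
    (h : (∑ a, E a).rank = ∑ a, (E a).rank) : ∃ T, IsOrthogonalFamily E T := by
  obtain ⟨T, hT⟩ := exists_mul_mul_eq_self (∑ a, E a)
  have hsub (s : Finset α) : (∑ a ∈ s, E a).rank = ∑ a ∈ s, (E a).rank := by
    have h1 := rank_add_le (∑ a ∈ s, E a) (∑ a ∈ sᶜ, E a)
    have h2 := rank_sum_le s E
    have h3 := rank_sum_le sᶜ E
    rw [Finset.sum_add_sum_compl, h, ← Finset.sum_add_sum_compl s] at h1
    omega
  refine ⟨T, fun a b => ?_⟩
  have key (a : α) := orthogonal_of_rank_add (A := E a) (C := ∑ b ∈ {a}ᶜ, E b) (T := T)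
    (by rw [hsub, ← Finset.sum_singleton E a, Finset.sum_add_sum_compl, h,
          ← Finset.sum_add_sum_compl {a}, Finset.sum_singleton, Finset.sum_singleton])
    (by rwa [← Finset.sum_singleton E a, Finset.sum_add_sum_compl])
  split_ifs with hab
  · rw [← hab]; exact (key a).1
  · have hb : b ∈ ({a}ᶜ : Finset α) := by simpa using fun h => hab h.symm
    -- The columns of `E b` lie in the column space of the sum over the complement of `a`, which `E
    -- a * T` annihilates.
    have h1 := (range_le_range_add_of_rank_add (A := E b) (C := ∑ c ∈ ({a}ᶜ : Finset α).erase b, E c)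
      (by rw [Finset.add_sum_erase _ _ hb, hsub, hsub, Finset.add_sum_erase _ (fun c => (E c).rank) hb])).1
    rw [Finset.add_sum_erase _ _ hb] at h1
    obtain ⟨K, hK⟩ := exists_eq_mul_of_range_le h1
    rw [hK, ← Matrix.mul_assoc, (key a).2.2.1, Matrix.zero_mul]

theorem exists_isUnit_mul_mul_eq {A B : Matrix m m F} (h : A.rank = B.rank) :
    ∃ g k : Matrix m m F, IsUnit g ∧ IsUnit k ∧ A = g * B * k := by
  obtain ⟨V, U, e, hV, hU, hA⟩ := exists_rank_normal_form A
  obtain ⟨V', U', e', hV', hU', hB⟩ := exists_rank_normal_form B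
  revert e hA
  rw [h]
  intro e hA
  have h1 : V * A * U = (V' * B * U').submatrix (e.trans e'.symm) (e.trans e'.symm) := by
    rw [hA, hB]
    ext i j
    simp
  set σ := e.trans e'.symm
  -- The two normal forms differ only by a relabelling of indices, here written with permutation
  -- matrices.
  have h2 : V * A * U = (1 : Matrix m m F).submatrix σ id * (V' * B * U') *
      (1 : Matrix m m F).submatrix id σ := by
    rw [h1]
    ext i j
    simp [Matrix.mul_apply, Matrix.one_apply]
  have u1 : IsUnit ((1 : Matrix m m F).submatrix σ id) := by
    apply IsUnit.of_mul_eq_one ((1 : Matrix m m F).submatrix id σ)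
    ext i j
    simp [Matrix.mul_apply, Matrix.one_apply]
  have u2 : IsUnit ((1 : Matrix m m F).submatrix id σ) := by
    apply IsUnit.of_mul_eq_one ((1 : Matrix m m F).submatrix σ id)
    ext i j
    rw [Matrix.mul_apply, ← σ.symm.sum_comp]
    simp [Matrix.one_apply]
  obtain ⟨V, rfl⟩ := hV
  obtain ⟨U, rfl⟩ := hU
  refine ⟨((V⁻¹ : (Matrix m m F)ˣ) : Matrix m m F) * (1 : Matrix m m F).submatrix σ id * V', U' * (1 : Matrix m m F).submatrix id σ *
    ((U⁻¹ : (Matrix m m F)ˣ) : Matrix m m F),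
    ((Units.isUnit _).mul u1).mul hV', (hU'.mul u2).mul (Units.isUnit _), ?_⟩
  have h3 : ((V⁻¹ : (Matrix m m F)ˣ) : Matrix m m F) * ((V : Matrix m m F) * A * (U : Matrix m m F)) *
      ((U⁻¹ : (Matrix m m F)ˣ) : Matrix m m F) = A := by
    rw [Matrix.mul_assoc (V : Matrix m m F), Units.inv_mul_cancel_left, Units.mul_inv_cancel_right]
  rw [h2] at h3
  simpa only [Matrix.mul_assoc] using h3.symm

end Rank

/-! ### Normal forms, factorizations, and row and column spans -/

section RankMore

open Matrix

variable {F : Type*} [Field F] {n : ℕ}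

theorem rank_isUnit_mul_mul {m : Type*} [Fintype m] [DecidableEq m] {g k : Matrix m m F}
    (hg : IsUnit g) (hk : IsUnit k) (B : Matrix m m F) : (g * B * k).rank = B.rank := by
  rw [rank_mul_eq_left_of_isUnit_det _ _ ((isUnit_iff_isUnit_det _).1 hk),
    rank_mul_eq_right_of_isUnit_det _ _ ((isUnit_iff_isUnit_det _).1 hg)]

/-- The diagonal matrix with ones at the first `s` places. -/
noncomputable def partialOne (F : Type*) [Field F] (n s : ℕ) : Matrix (Fin n) (Fin n) F :=
  diagonal fun i => if i.val < s then 1 else 0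

theorem rank_partialOne {s : ℕ} (hs : s ≤ n) : (partialOne F n s).rank = s := by
  classical
  rw [partialOne, rank_diagonal]
  simp only [ne_eq, ite_eq_right_iff, one_ne_zero, imp_false, not_not]
  rw [Fintype.card_subtype, Fin.card_filter_val_lt, min_eq_right hs]

theorem partialOne_mul_partialOne (s t : ℕ) :
    partialOne F n s * partialOne F n t = partialOne F n (min s t) := by
  rw [partialOne, partialOne, partialOne, diagonal_mul_diagonal]
  congr 1
  ext i
  by_cases h1 : i.val < s <;> by_cases h2 : i.val < t <;> simp [h1, h2]

theorem rank_partialOne_sub {s t : ℕ} (hst : s ≤ t) (ht : t ≤ n) :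
    (partialOne F n t - partialOne F n s).rank = t - s := by
  have h := rank_add_of_orthogonal (A := partialOne F n s)
    (C := partialOne F n t - partialOne F n s) (T := 1)
    (by simp [partialOne_mul_partialOne])
    (by simp [partialOne_mul_partialOne, Matrix.mul_sub, Matrix.sub_mul, hst])
    (by simp [partialOne_mul_partialOne, Matrix.mul_sub, hst])
    (by simp [partialOne_mul_partialOne, Matrix.sub_mul, hst])
  rw [add_sub_cancel, rank_partialOne ht, rank_partialOne (hst.trans ht)] at h
  omega

theorem exists_eq_mul_partialOne_mul (E : Matrix (Fin n) (Fin n) F) :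
    ∃ g k : Matrix (Fin n) (Fin n) F, IsUnit g ∧ IsUnit k ∧ E = g * partialOne F n E.rank * k :=
  exists_isUnit_mul_mul_eq (rank_partialOne (E.rank_le_height)).symm

theorem exists_rank_sub (E : Matrix (Fin n) (Fin n) F) {t : ℕ} (ht : t ≤ E.rank) :
    ∃ A : Matrix (Fin n) (Fin n) F, A.rank = t ∧ (E - A).rank = E.rank - t := by
  obtain ⟨g, k, hg, hk, hE⟩ := exists_eq_mul_partialOne_mul E
  refine ⟨g * partialOne F n t * k, ?_, ?_⟩
  · rw [rank_isUnit_mul_mul hg hk, rank_partialOne (ht.trans E.rank_le_height)]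
  · conv_lhs => rw [hE]
    rw [← Matrix.sub_mul, ← Matrix.mul_sub, rank_isUnit_mul_mul hg hk,
      rank_partialOne_sub ht E.rank_le_height]

theorem exists_rank_add (S : Matrix (Fin n) (Fin n) F) {t : ℕ} (ht : S.rank + t ≤ n) :
    ∃ B : Matrix (Fin n) (Fin n) F, B.rank = t ∧ (S + B).rank = S.rank + t := by
  obtain ⟨g, k, hg, hk, hE⟩ := exists_eq_mul_partialOne_mul S
  refine ⟨g * (partialOne F n (S.rank + t) - partialOne F n S.rank) * k, ?_, ?_⟩
  · rw [rank_isUnit_mul_mul hg hk, rank_partialOne_sub (Nat.le_add_right _ _) ht]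
    omega
  · conv_lhs => enter [1, 1]; rw [hE]
    rw [← Matrix.add_mul, ← Matrix.mul_add, rank_isUnit_mul_mul hg hk, add_sub_cancel,
      rank_partialOne ht]

theorem exists_rank_factorization {E : Matrix (Fin n) (Fin n) F} {s : ℕ} (hs : E.rank = s) :
    ∃ (U : Matrix (Fin n) (Fin s) F) (V : Matrix (Fin s) (Fin n) F)
      (U' : Matrix (Fin s) (Fin n) F) (V' : Matrix (Fin n) (Fin s) F),
      U' * U = 1 ∧ V * V' = 1 ∧ E = U * V := by
  obtain ⟨g, k, hg, hk, hE⟩ := exists_eq_mul_partialOne_mul E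
  rw [hs] at hE
  have hsn : s ≤ n := hs ▸ E.rank_le_height
  obtain ⟨g', hg'⟩ := hg.exists_left_inv
  obtain ⟨k', hk'⟩ := hk.exists_right_inv
  -- The inclusion of the first `s` coordinates, so that `J * Jᵀ` is the normal form of rank `s`.
  set J : Matrix (Fin n) (Fin s) F := Matrix.of fun i j => if i = Fin.castLE hsn j then 1 else 0
  have h1 : Jᵀ * J = 1 := by
    ext i j
    simp [J, Matrix.mul_apply, Matrix.one_apply, eq_comm]
  have h2 : J * Jᵀ = partialOne F n s := by
    ext i j
    rw [Matrix.mul_apply]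
    simp only [J, Matrix.of_apply, Matrix.transpose_apply, partialOne, diagonal_apply, mul_ite,
      mul_one, mul_zero]
    by_cases hi : i.val < s
    · rw [Finset.sum_eq_single ⟨i, hi⟩]
      · simp only [Fin.castLE_mk, Fin.eta, hi, if_true]
        simp [eq_comm]
      · intro b _ hb
        have : i ≠ Fin.castLE hsn b := fun h => hb (by ext; simp [h])
        simp [this]
      · simp
    · have : ∀ b, i ≠ Fin.castLE hsn b := fun b h => hi (by simp [h])
      simp [this, hi]
  refine ⟨g * J, Jᵀ * k, Jᵀ * g', k' * J, ?_, ?_, ?_⟩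
  · rw [Matrix.mul_assoc, ← Matrix.mul_assoc g', hg', Matrix.one_mul, h1]
  · rw [Matrix.mul_assoc, ← Matrix.mul_assoc k, hk', Matrix.one_mul, h1]
  · rw [hE, ← h2]
    simp only [Matrix.mul_assoc]

theorem exists_eq_vecMulVec {E : Matrix (Fin n) (Fin n) F} (hE : E.rank = 1) :
    ∃ a b : Fin n → F, E = vecMulVec a b := by
  obtain ⟨U, V, -, -, -, -, h⟩ := exists_rank_factorization hE
  refine ⟨fun i => U i 0, fun j => V 0 j, ?_⟩
  rw [h]
  ext i j
  simp [Matrix.mul_apply, vecMulVec_apply]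

theorem sum_vecMulVec {κ : Type*} [Fintype κ] (a b : κ → Fin n → F) :
    ∑ k, vecMulVec (a k) (b k) = (Matrix.of a)ᵀ * Matrix.of b := by
  ext i j
  simp [Matrix.mul_apply, vecMulVec_apply, Matrix.sum_apply]

theorem linearIndependent_of_rank_eq {κ : Type*} [Fintype κ] {a : κ → Fin n → F}
    (h : Fintype.card κ ≤ (Matrix.of a).rank) : LinearIndependent F a := by
  rw [rank_eq_finrank_span_row] at h
  rw [linearIndependent_iff_card_le_finrank_span]
  exact h

theorem linearIndependent_of_rank_sum {κ : Type*} [Fintype κ] {a b : κ → Fin n → F}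
    (h : (∑ k, vecMulVec (a k) (b k)).rank = Fintype.card κ) :
    LinearIndependent F a ∧ LinearIndependent F b := by
  rw [sum_vecMulVec] at h
  refine ⟨linearIndependent_of_rank_eq ?_, linearIndependent_of_rank_eq ?_⟩
  · rw [← rank_transpose, ← h]
    exact rank_mul_le_left _ _
  · rw [← h]
    exact rank_mul_le_right _ _

theorem rank_transpose_mul_of_linearIndependent {κ : Type*} [Fintype κ] {a b : κ → Fin n → F}
    (ha : LinearIndependent F a) (hb : LinearIndependent F b) :
    ((Matrix.of a)ᵀ * Matrix.of b).rank = Fintype.card κ := by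
  classical
  have h1 : Function.Injective (Matrix.of a)ᵀ.mulVecLin :=
    Matrix.mulVec_injective_iff.mpr ha
  have h2 : (Matrix.of b).rank = Fintype.card κ := LinearIndependent.rank_matrix hb
  unfold Matrix.rank at h2 ⊢
  rw [Matrix.mulVecLin_mul, LinearMap.range_comp, ← h2]
  exact (Submodule.equivMapOfInjective _ h1 _).finrank_eq.symm

theorem rank_sum_vecMulVec {κ : Type*} [Fintype κ] {a b : κ → Fin n → F}
    (ha : LinearIndependent F a) (hb : LinearIndependent F b) :
    (∑ k, vecMulVec (a k) (b k)).rank = Fintype.card κ := by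
  rw [sum_vecMulVec, rank_transpose_mul_of_linearIndependent ha hb]

theorem colSpan_eq_range (A : Matrix (Fin n) (Fin n) F) :
    colSpan A = LinearMap.range A.mulVecLin := (Matrix.range_mulVecLin A).symm

theorem rowSpan_eq_range (A : Matrix (Fin n) (Fin n) F) :
    rowSpan A = LinearMap.range Aᵀ.mulVecLin := (Matrix.range_mulVecLin Aᵀ).symm

theorem exists_mul_eq_of_disjoint {A B : Matrix (Fin n) (Fin n) F}
    (h : LinearMap.range A.mulVecLin ⊓ LinearMap.range B.mulVecLin = ⊥) :
    ∃ P : Matrix (Fin n) (Fin n) F, P * A = A ∧ P * B = 0 := by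
  obtain ⟨Q, hQ, hc⟩ := (disjoint_iff.mpr h).exists_isCompl
  have key (M : Matrix (Fin n) (Fin n) F) (v : Fin n → F) :
      (LinearMap.toMatrix' (Q.projection _ hc) * M) *ᵥ v = Q.projection _ hc (M *ᵥ v) := by
    rw [← Matrix.mulVec_mulVec, LinearMap.toMatrix'_mulVec]
  refine ⟨LinearMap.toMatrix' (Q.projection _ hc), ?_, ?_⟩
  · refine Matrix.ext_of_mulVec_single fun i => ?_
    rw [key]
    exact Submodule.projection_apply_of_mem_left hc (hQ ⟨_, rfl⟩)
  · refine Matrix.ext_of_mulVec_single fun i => ?_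
    rw [key, Matrix.zero_mulVec]
    exact Submodule.projection_apply_of_mem_right hc ⟨_, rfl⟩

/-- This turns the span conditions of `walk₂` into rank additivity. For the converse direction, a
projection `P` separating the row spaces gives `B = (A + B) * Pᵀ` and `A = (A + B) * (1 - Pᵀ)`. The
column space of the sum therefore contains both column spaces, which are independent. -/
theorem rank_add_iff (A B : Matrix (Fin n) (Fin n) F) :
    (A + B).rank = A.rank + B.rank ↔
      rowSpan B ⊓ rowSpan A = ⊥ ∧ colSpan B ⊓ colSpan A = ⊥ := by
  simp only [colSpan_eq_range, rowSpan_eq_range]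
  constructor
  · intro h
    have h' : (Bᵀ + Aᵀ).rank = Bᵀ.rank + Aᵀ.rank := by
      rw [← Matrix.transpose_add, rank_transpose, rank_transpose, rank_transpose, add_comm, h,
        add_comm]
    rw [add_comm A, add_comm A.rank] at h
    exact ⟨(range_le_range_add_of_rank_add h').2, (range_le_range_add_of_rank_add h).2⟩
  · rintro ⟨h1, h2⟩
    obtain ⟨P, hPB, hPA⟩ := exists_mul_eq_of_disjoint h1
    have hB : B = (A + B) * Pᵀ := by
      have h3 := congrArg Matrix.transpose hPB
      have h4 := congrArg Matrix.transpose hPA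
      rw [Matrix.transpose_mul, Matrix.transpose_transpose] at h3 h4
      rw [Matrix.add_mul, h3, h4, Matrix.transpose_zero, zero_add]
    have hA : A = (A + B) * (1 - Pᵀ) := by
      rw [Matrix.mul_sub, ← hB, Matrix.mul_one, add_sub_cancel_right]
    refine le_antisymm (rank_add_le _ _) ?_
    have hA' : LinearMap.range A.mulVecLin ≤ LinearMap.range (A + B).mulVecLin := by
      conv_lhs => rw [hA, Matrix.mulVecLin_mul]
      exact LinearMap.range_comp_le_range _ _
    have hB' : LinearMap.range B.mulVecLin ≤ LinearMap.range (A + B).mulVecLin := by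
      conv_lhs => rw [hB, Matrix.mulVecLin_mul]
      exact LinearMap.range_comp_le_range _ _
    have h3 := Submodule.finrank_sup_add_finrank_inf_eq (LinearMap.range B.mulVecLin)
      (LinearMap.range A.mulVecLin)
    rw [h2, finrank_bot, add_zero] at h3
    unfold Matrix.rank
    rw [add_comm, ← h3]
    exact Submodule.finrank_mono (sup_le hB' hA')

/-- A basis of `C` as columns times a basis of `R` as rows. -/
theorem exists_rowSpan_colSpan {R C : Submodule F (Fin n → F)} {s : ℕ}
    (hR : Module.finrank F R = s) (hC : Module.finrank F C = s) :
    ∃ S : Matrix (Fin n) (Fin n) F, S.rank = s ∧ rowSpan S = R ∧ colSpan S = C := by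
  let bR := Module.finBasisOfFinrankEq F R hR
  let bC := Module.finBasisOfFinrankEq F C hC
  let a : Fin s → Fin n → F := fun i => bC i
  let b : Fin s → Fin n → F := fun i => bR i
  have ha : LinearIndependent F a := bC.linearIndependent.map' C.subtype C.ker_subtype
  have hb : LinearIndependent F b := bR.linearIndependent.map' R.subtype R.ker_subtype
  have h := rank_transpose_mul_of_linearIndependent ha hb
  rw [Fintype.card_fin] at h
  have hle (a b : Fin s → Fin n → F) (W : Submodule F (Fin n → F)) (h : ∀ i, a i ∈ W) :
      LinearMap.range ((Matrix.of a)ᵀ * Matrix.of b).mulVecLin ≤ W := by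
    rw [Matrix.mulVecLin_mul]
    refine (LinearMap.range_comp_le_range _ _).trans ?_
    rw [Matrix.range_mulVecLin, Submodule.span_le]
    rintro _ ⟨i, rfl⟩
    exact h i
  refine ⟨_, h, ?_, ?_⟩
  · rw [rowSpan_eq_range, Matrix.transpose_mul, Matrix.transpose_transpose]
    refine Submodule.eq_of_le_of_finrank_eq (hle b a R fun i => (bR i).2) ?_
    rw [hR]
    have := rank_transpose_mul_of_linearIndependent hb ha
    rwa [Fintype.card_fin] at this
  · rw [colSpan_eq_range]
    refine Submodule.eq_of_le_of_finrank_eq (hle a b C fun i => (bC i).2) ?_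
    rw [hC]
    exact h

end RankMore

/-! ### Frames: existence on subspaces and uniqueness -/

section Frame

open Matrix

variable {F : Type*} [Field F] [Algebra (ZMod 2) F] {n : ℕ}
variable {ι κ : Type*} [Fintype ι] [DecidableEq ι] [Fintype κ] [DecidableEq κ]

theorem zmod_two_eq_zero_or_one (c : ZMod 2) : c = 0 ∨ c = 1 := by
  revert c; decide

theorem zmod_two_smul {M : Type*} [AddCommGroup M] [Module (ZMod 2) M] (c : ZMod 2) (x : M) :
    c • x = if c = 1 then x else 0 := by
  rcases zmod_two_eq_zero_or_one c with rfl | rfl <;> simp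

theorem zmod_two_sum_smul {α M : Type*} [Fintype α] [AddCommGroup M] [Module (ZMod 2) M]
    (c : α → ZMod 2) (x : α → M) : ∑ a, c a • x a = ∑ a with c a = 1, x a := by
  rw [Finset.sum_filter]
  exact Finset.sum_congr rfl fun a _ => zmod_two_smul _ _

theorem exists_dotProduct_eq {φ χ : ι → ZMod 2} (hφ : φ ≠ 0) (h : χ ≠ φ) :
    ∃ a : ι → ZMod 2, a ⬝ᵥ φ = 1 ∧ a ⬝ᵥ χ = 0 := by
  have h1 (c : ZMod 2) (hc : c ≠ 0) : c = 1 := (zmod_two_eq_zero_or_one c).resolve_left hc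
  by_cases hj : ∃ j, φ j = 1 ∧ χ j = 0
  · obtain ⟨j, hj, hj'⟩ := hj
    exact ⟨Pi.single j 1, by simp [hj], by simp [hj']⟩
  -- Now the support of `χ` strictly contains that of `φ`; adding a coordinate `l` in the difference
  -- to one in the support of `φ` makes `χ` vanish.
  · push Not at hj
    obtain ⟨j, hφj⟩ := Function.ne_iff.mp hφ
    have hφj := h1 _ hφj
    have hχj := h1 _ (hj j hφj)
    obtain ⟨l, hl⟩ := Function.ne_iff.mp h
    have hφl : φ l = 0 := by
      by_contra h0
      exact hl (by rw [h1 _ h0, h1 _ (hj l (h1 _ h0))])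
    have hχl : χ l = 1 := h1 _ fun h0 => hl (by rw [h0, hφl])
    refine ⟨Pi.single j 1 + Pi.single l 1, ?_, ?_⟩
    · simp [add_dotProduct, hφj, hφl]
    · simp only [add_dotProduct, single_dotProduct, hχj, hχl]
      decide

/-- The matrices `v i` are sums of members of a rank-additive family `E` of matrices of rank `ρ`
which is indexed by the nonzero functionals on the span of `v`. -/
structure IsFrame (ρ : ℕ) (v : ι → Matrix (Fin n) (Fin n) F)
    (E : (ι → ZMod 2) → Matrix (Fin n) (Fin n) F) : Prop where
  zero : E 0 = 0
  orth : ∃ T, IsOrthogonalFamily E T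
  rank : ∀ φ, φ ≠ 0 → (E φ).rank = ρ
  eq : ∀ i, v i = ∑ φ, φ i • E φ

variable {ρ : ℕ} {v : ι → Matrix (Fin n) (Fin n) F} {E : (ι → ZMod 2) → Matrix (Fin n) (Fin n) F}

theorem IsFrame.sum_smul (h : IsFrame ρ v E) (a : ι → ZMod 2) :
    ∑ i, a i • v i = ∑ φ with a ⬝ᵥ φ = 1, E φ := by
  rw [← zmod_two_sum_smul]
  simp_rw [h.eq, Finset.smul_sum, smul_smul]
  rw [Finset.sum_comm]
  exact Finset.sum_congr rfl fun φ _ => by rw [← Finset.sum_smul]; rfl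

/-- For `χ ≠ φ`, some combination `x` of the `v i` involves `E' φ` but not `E χ`. Inserting `x * T'`
shows that `E χ * T * E' φ = E χ * T * x * T' * E' φ = 0`. With the off-diagonal products gone,
expanding an `x` that involves `φ` in either frame identifies both `E φ` and `E' φ` with `E φ * T *
E' φ`. -/
theorem IsFrame.unique (h : IsFrame ρ v E) {ρ' : ℕ}
    {E' : (ι → ZMod 2) → Matrix (Fin n) (Fin n) F} (h' : IsFrame ρ' v E') : E' = E := by
  obtain ⟨T, hT⟩ := h.orth
  obtain ⟨T', hT'⟩ := h'.orth
  have key (φ χ : ι → ZMod 2) (hφ : φ ≠ 0) (hχ : χ ≠ φ) : E χ * T * E' φ = 0 := by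
    obtain ⟨a, ha, ha'⟩ := exists_dotProduct_eq hφ hχ
    have h1 : (∑ i, a i • v i) * T' * E' φ = E' φ := by
      rw [h'.sum_smul, ← Finset.sum_singleton E' φ, hT'.sum_mul_sum,
        Finset.inter_singleton_of_mem (by simpa using ha)]
    have h2 : E χ * T * ∑ i, a i • v i = 0 := by
      rw [h.sum_smul, hT.mul_sum, if_neg (by simp [ha'])]
    rw [← h1, ← Matrix.mul_assoc, ← Matrix.mul_assoc, h2, Matrix.zero_mul, Matrix.zero_mul]
  funext φ
  by_cases hφ : φ = 0
  · rw [hφ, h.zero, h'.zero]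
  obtain ⟨a, ha, -⟩ := exists_dotProduct_eq hφ (Ne.symm hφ)
  have h1 : E φ * T * ∑ i, a i • v i = E φ := by
    rw [h.sum_smul, hT.mul_sum, if_pos (by simp [ha])]
  have h2 : (∑ i, a i • v i) * T * E' φ = E φ * T * E' φ := by
    rw [h.sum_smul, Matrix.sum_mul, Matrix.sum_mul, Finset.sum_eq_single φ]
    · intro χ _ hχ
      exact key φ χ hφ hχ
    · simp [ha]
  have h3 : E φ * T * ∑ i, a i • v i = E φ * T * E' φ := by
    rw [h'.sum_smul, Matrix.mul_sum, Finset.sum_eq_single φ]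
    · intro χ _ hχ
      by_cases hχ0 : χ = 0
      · rw [hχ0, h'.zero, Matrix.mul_zero]
      · exact key χ φ hχ0 hχ.symm
    · simp [ha]
  have h4 : (∑ i, a i • v i) * T * (∑ i, a i • v i) = ∑ i, a i • v i := by
    rw [h.sum_smul, hT.sum_mul_sum, Finset.inter_self]
  have h5 : (∑ i, a i • v i) * T' * E' φ = E' φ := by
    rw [h'.sum_smul, ← Finset.sum_singleton E' φ, hT'.sum_mul_sum,
      Finset.inter_singleton_of_mem (by simpa using ha)]
  rw [← h1, h3, ← h2]
  conv_rhs => rw [← h5, ← Matrix.mul_assoc, ← Matrix.mul_assoc, h4]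
  exact h5.symm

/-- If `a i = 1`, the member at the `i`-th coordinate functional is recovered from `∑ a i • v i`, so
a vanishing combination would make its rank zero. -/
theorem IsFrame.linearIndependent (h : IsFrame ρ v E) (hρ : 0 < ρ) :
    LinearIndependent (ZMod 2) v := by
  rw [Fintype.linearIndependent_iff]
  intro a ha i
  by_contra hi
  have hi := (zmod_two_eq_zero_or_one (a i)).resolve_left hi
  obtain ⟨T, hT⟩ := h.orth
  have h1 : E (Pi.single i 1) * T * ∑ i, a i • v i = E (Pi.single i 1) := by
    rw [h.sum_smul, hT.mul_sum, if_pos (by simp [hi])]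
  rw [ha, Matrix.mul_zero] at h1
  have h2 := h.rank (Pi.single i 1) (by simp)
  rw [← h1, Matrix.rank_zero] at h2
  omega

/-- Sums over the fibres of `c` are again orthogonal. The fibre over `0` is discarded, since its
members have coefficient zero in every new vector. -/
theorem IsFrame.map (h : IsFrame ρ v E) (c : (ι → ZMod 2) →ₗ[ZMod 2] (κ → ZMod 2)) {N : ℕ}
    (hN : ∀ ψ, Finset.card {φ | c φ = ψ} = N) :
    IsFrame (N * ρ) (fun j => ∑ φ, c φ j • E φ)
      fun ψ => if ψ = 0 then 0 else ∑ φ with c φ = ψ, E φ := by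
  obtain ⟨T, hT⟩ := h.orth
  refine ⟨if_pos rfl, ⟨T, ?_⟩, fun ψ hψ => ?_, fun j => ?_⟩
  · have := hT.biUnion (fun ψ : κ → ZMod 2 => if ψ = 0 then ∅ else
      Finset.univ.filter fun φ => c φ = ψ) ?_
    · convert this using 2 with ψ
      split_ifs <;> simp
    · intro b c' hbc
      split_ifs with h1 h2
      · simp
      · simp
      · simp
      · rw [Finset.disjoint_filter]
        exact fun φ _ h3 h4 => hbc (h3.symm.trans h4)
  · rw [if_neg hψ, hT.rank_sum, ← hN ψ, ← smul_eq_mul, ← Finset.sum_const]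
    refine Finset.sum_congr rfl fun φ hφ => h.rank φ ?_
    rintro rfl
    simp only [map_zero, Finset.mem_filter, Finset.mem_univ, true_and] at hφ
    exact hψ hφ.symm
  · rw [← Finset.sum_fiberwise Finset.univ c]
    refine Finset.sum_congr rfl fun ψ _ => ?_
    split_ifs with hψ
    · rw [smul_zero]
      refine Finset.sum_eq_zero fun φ hφ => ?_
      rw [(Finset.mem_filter.mp hφ).2, hψ, Pi.zero_apply, zero_smul]
    · rw [Finset.smul_sum]
      exact Finset.sum_congr rfl fun φ hφ => by rw [(Finset.mem_filter.mp hφ).2]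

/-- The coordinate matrix of `w` in terms of `v` has independent rows, so it maps functionals onto
functionals with fibres of equal size. The frame of `w` is obtained by summing over these fibres. -/
theorem IsFrame.exists_of_mem_span (h : IsFrame ρ v E) {w : κ → Matrix (Fin n) (Fin n) F}
    (hw : LinearIndependent (ZMod 2) w)
    (hmem : ∀ j, w j ∈ Submodule.span (ZMod 2) (Set.range v)) {ρ' : ℕ}
    (hρ : ρ' * 2 ^ Fintype.card κ = ρ * 2 ^ Fintype.card ι) :
    ∃ E', IsFrame ρ' w E' := by
  have h1 (j : κ) := Submodule.mem_span_range_iff_exists_fun (ZMod 2) |>.mp (hmem j)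
  choose c hc using h1
  set C : Matrix κ ι (ZMod 2) := Matrix.of c
  have hC : LinearIndependent (ZMod 2) C.row := by
    rw [Fintype.linearIndependent_iff] at hw ⊢
    intro a ha
    refine hw a ?_
    simp_rw [← hc, Finset.smul_sum, smul_smul]
    rw [Finset.sum_comm]
    refine Finset.sum_eq_zero fun i _ => ?_
    rw [← Finset.sum_smul]
    have : ∑ j, a j * c j i = 0 := by simpa [C] using congrFun ha i
    rw [this, zero_smul]
  have hsurj : Function.Surjective C.mulVecLin := by
    rw [← LinearMap.range_eq_top]
    apply Submodule.eq_top_of_finrank_eq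
    rw [Module.finrank_fintype_fun_eq_card]
    exact hC.rank_matrix
  have hN (ψ : κ → ZMod 2) : Finset.card {φ | C.mulVecLin φ = ψ} =
      Finset.card {φ | C.mulVecLin φ = 0} :=
    AddMonoidHom.card_fiber_eq_of_mem_range C.mulVecLin (hsurj ψ) (hsurj 0)
  have hcard : 2 ^ Fintype.card ι =
      2 ^ Fintype.card κ * Finset.card {φ | C.mulVecLin φ = 0} := by
    have := Finset.card_eq_sum_card_fiberwise (f := C.mulVecLin) (s := Finset.univ)
      (t := Finset.univ) (by simp)
    rw [Finset.sum_congr rfl fun ψ _ => hN ψ] at this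
    simpa [ZMod.card] using this
  have hfr := h.map C.mulVecLin hN
  have hρ' : Finset.card {φ | C.mulVecLin φ = 0} * ρ = ρ' := by
    rw [hcard] at hρ
    have h2 : 0 < 2 ^ Fintype.card κ := by positivity
    refine Nat.eq_of_mul_eq_mul_right h2 ?_
    rw [hρ]; ring
  rw [hρ'] at hfr
  have hw' : w = fun j => ∑ φ, C.mulVecLin φ j • E φ := by
    funext j
    rw [← hc j]
    simp_rw [h.eq, Finset.smul_sum, smul_smul]
    rw [Finset.sum_comm]
    refine Finset.sum_congr rfl fun φ _ => ?_
    rw [← Finset.sum_smul]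
    rfl
  exact ⟨_, hw' ▸ hfr⟩

end Frame

/-! ### Adding one or two vectors to a frame: halves and quarters -/

section Split

open Matrix

variable {F : Type*} [Field F] [Algebra (ZMod 2) F] {n : ℕ}
variable {ι : Type*} [Fintype ι] [DecidableEq ι]

/-- Extend a family by one more member, with index `none`. -/
def optionCons {α : Type*} (a : α) (f : ι → α) : Option ι → α := fun o => o.elim a f

@[simp]
theorem optionCons_none {α : Type*} (a : α) (f : ι → α) : optionCons a f none = a := rfl

@[simp]
theorem optionCons_some {α : Type*} (a : α) (f : ι → α) (i : ι) : optionCons a f (some i) = f i :=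
  rfl

theorem optionCons_eta {α : Type*} (f : Option ι → α) :
    optionCons (f none) (fun i => f (some i)) = f := by
  funext o
  cases o <;> rfl

theorem optionCons_inj {α : Type*} {a b : α} {f g : ι → α} :
    optionCons a f = optionCons b g ↔ a = b ∧ f = g :=
  ⟨fun h => ⟨congrFun h none, funext fun i => congrFun h (some i)⟩, fun h => by rw [h.1, h.2]⟩

theorem optionCons_zero : optionCons (0 : ZMod 2) (0 : ι → ZMod 2) = 0 := by
  funext o
  cases o <;> rfl

theorem optionCons_one_ne_zero (φ : ι → ZMod 2) : optionCons (1 : ZMod 2) φ ≠ 0 :=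
  fun h => one_ne_zero (congrFun h none)

theorem optionCons_ne_zero (t : ZMod 2) {φ : ι → ZMod 2} (hφ : φ ≠ 0) : optionCons t φ ≠ 0 :=
  fun h => hφ (funext fun i => congrFun h (some i))

theorem forall_optionCons {p : (Option ι → ZMod 2) → Prop} (h0 : ∀ φ, p (optionCons 0 φ))
    (h1 : ∀ φ, p (optionCons 1 φ)) (φ : Option ι → ZMod 2) : p φ := by
  rw [← optionCons_eta φ]
  rcases zmod_two_eq_zero_or_one (φ none) with h | h <;> rw [h]
  · exact h0 _
  · exact h1 _

theorem sum_optionCons {M : Type*} [AddCommMonoid M] (f : (Option ι → ZMod 2) → M) :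
    ∑ φ, f φ = ∑ φ : ι → ZMod 2, (f (optionCons 0 φ) + f (optionCons 1 φ)) := by
  let e : ZMod 2 × (ι → ZMod 2) ≃ (Option ι → ZMod 2) :=
    { toFun := fun p => optionCons p.1 p.2
      invFun := fun f => (f none, fun i => f (some i))
      left_inv := fun _ => rfl
      right_inv := optionCons_eta }
  rw [← e.sum_comp, Fintype.sum_prod_type_right]
  exact Finset.sum_congr rfl fun φ _ => Fin.sum_univ_two fun t : ZMod 2 => f (optionCons t φ)

/-- The restriction of functionals from `Option ι` to `ι`. -/
def restrictSome (ι : Type*) : (Option ι → ZMod 2) →ₗ[ZMod 2] (ι → ZMod 2) :=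
  LinearMap.funLeft (ZMod 2) (ZMod 2) some

theorem filter_restrictSome (ψ : ι → ZMod 2) :
    (Finset.univ.filter fun φ => restrictSome ι φ = ψ) = {optionCons 0 ψ, optionCons 1 ψ} := by
  ext φ
  revert φ
  refine forall_optionCons (fun φ => ?_) fun φ => ?_
  all_goals
    simp only [Finset.mem_filter, Finset.mem_univ, true_and, Finset.mem_insert,
      Finset.mem_singleton, optionCons_inj, zero_ne_one, one_ne_zero, false_and, false_or, or_false]
    exact Iff.rfl

theorem card_filter_restrictSome (ψ : ι → ZMod 2) :
    Finset.card {φ | restrictSome ι φ = ψ} = 2 := by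
  rw [filter_restrictSome, Finset.card_pair]
  simp [optionCons_inj]

variable {ρ : ℕ}

/-- Restricting a frame to all but one of the vectors. -/
theorem IsFrame.tail {v : Option ι → Matrix (Fin n) (Fin n) F}
    {E : (Option ι → ZMod 2) → Matrix (Fin n) (Fin n) F} (h : IsFrame ρ v E) :
    IsFrame (2 * ρ) (fun i => v (some i))
      fun ψ => if ψ = 0 then 0 else E (optionCons 0 ψ) + E (optionCons 1 ψ) := by
  have := h.map (restrictSome ι) card_filter_restrictSome
  convert this using 2 with i ψ
  · exact h.eq (some i)
  · rw [filter_restrictSome, Finset.sum_pair]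
    simp [optionCons_inj]

variable {v : ι → Matrix (Fin n) (Fin n) F} {E : (ι → ZMod 2) → Matrix (Fin n) (Fin n) F}

/-- `A` splits every `E φ` with `φ ≠ 0` into two halves of rank `ρ`, and `A 0` is a matrix of
rank `ρ` which is independent of `E`. -/
structure IsHalf (ρ : ℕ) (E A : (ι → ZMod 2) → Matrix (Fin n) (Fin n) F) : Prop where
  rank : ∀ φ, (A φ).rank = ρ
  sub : ∀ φ, φ ≠ 0 → (E φ - A φ).rank = ρ
  add : (∑ φ, E φ + A 0).rank = (∑ φ, E φ).rank + ρ

/-- The members of the split family. -/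
def splitFamily (E A : (ι → ZMod 2) → Matrix (Fin n) (Fin n) F) (φ : Option ι → ZMod 2) :
    Matrix (Fin n) (Fin n) F :=
  if φ none = 1 then A fun i => φ (some i) else
    if (fun i => φ (some i)) = 0 then 0 else (E fun i => φ (some i)) - A fun i => φ (some i)

theorem splitFamily_one (E A : (ι → ZMod 2) → Matrix (Fin n) (Fin n) F) (φ : ι → ZMod 2) :
    splitFamily E A (optionCons 1 φ) = A φ := by
  simp [splitFamily]

theorem splitFamily_zero (E A : (ι → ZMod 2) → Matrix (Fin n) (Fin n) F) (φ : ι → ZMod 2) :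
    splitFamily E A (optionCons 0 φ) = if φ = 0 then 0 else E φ - A φ :=
  if_neg zero_ne_one

theorem IsFrame.sum_splitFamily (h : IsFrame (2 * ρ) v E)
    (A : (ι → ZMod 2) → Matrix (Fin n) (Fin n) F) :
    ∑ φ, splitFamily E A φ = ∑ φ, E φ + A 0 := by
  have hA : A 0 = ∑ φ : ι → ZMod 2, if φ = 0 then A φ else 0 := by simp
  rw [sum_optionCons, hA, ← Finset.sum_add_distrib]
  refine Finset.sum_congr rfl fun φ _ => ?_
  rw [splitFamily_zero, splitFamily_one]
  split_ifs with hφ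
  · rw [hφ, h.zero]
  · rw [sub_add_cancel, add_zero]

theorem IsFrame.rank_sum (h : IsFrame ρ v E) (s : Finset (ι → ZMod 2)) :
    (∑ φ ∈ s, E φ).rank = ∑ φ ∈ s, (E φ).rank := by
  obtain ⟨T, hT⟩ := h.orth
  exact hT.rank_sum s

/-- The left side is the sum of the ranks in a split family: two halves for each `φ ≠ 0` and the
single fresh matrix for `φ = 0`. -/
theorem IsFrame.sum_rank (h : IsFrame (2 * ρ) v E) :
    ∑ φ : ι → ZMod 2, (if φ = 0 then ρ else 2 * ρ) = (∑ φ, E φ).rank + ρ := by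
  rw [h.rank_sum, ← Finset.add_sum_erase _ _ (Finset.mem_univ (0 : ι → ZMod 2)),
    ← Finset.add_sum_erase _ (fun φ => (E φ).rank) (Finset.mem_univ (0 : ι → ZMod 2)), if_pos rfl,
    h.zero, Matrix.rank_zero, zero_add, add_comm]
  congr 1
  refine Finset.sum_congr rfl fun φ hφ => ?_
  rw [if_neg (Finset.ne_of_mem_erase hφ), h.rank φ (Finset.ne_of_mem_erase hφ)]

/-- The new index is `none`: functionals with value `1` there carry `A`, those with value `0` carry
the remainders. The split family sums to `∑ E φ + A 0`, whose rank equals the sum of the ranks, and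
this is all that orthogonality needs. -/
theorem IsHalf.isFrame {A : (ι → ZMod 2) → Matrix (Fin n) (Fin n) F} (hA : IsHalf ρ E A)
    (h : IsFrame (2 * ρ) v E) : IsFrame ρ (optionCons (∑ φ, A φ) v) (splitFamily E A) := by
  refine ⟨?_, exists_isOrthogonalFamily ?_, ?_, ?_⟩
  · rw [← optionCons_zero, splitFamily_zero, if_pos rfl]
  · rw [h.sum_splitFamily, hA.add, sum_optionCons, ← h.sum_rank]
    refine Finset.sum_congr rfl fun φ _ => ?_
    rw [splitFamily_zero, splitFamily_one, hA.rank]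
    split_ifs with hφ
    · simp
    · rw [hA.sub φ hφ, two_mul]
  · refine forall_optionCons (fun φ hφ => ?_) fun φ _ => ?_
    · have : φ ≠ 0 := fun h0 => hφ (h0 ▸ optionCons_zero)
      rw [splitFamily_zero, if_neg this, hA.sub φ this]
    · rw [splitFamily_one, hA.rank]
  · rintro (_ | i)
    · rw [sum_optionCons, optionCons_none]
      simp [splitFamily_one]
    · rw [sum_optionCons, optionCons_some, h.eq]
      refine Finset.sum_congr rfl fun φ _ => ?_
      rw [splitFamily_zero, splitFamily_one]
      simp only [optionCons_some]
      split_ifs with hφ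
      · simp [hφ]
      · rw [← smul_add, sub_add_cancel]

/-- Uniqueness forces `E` to be the restriction of `E'`, so every `E φ` with `φ ≠ 0` is the sum of
the two members of `E'` above `φ`. -/
theorem IsFrame.isHalf {m : Matrix (Fin n) (Fin n) F}
    {E' : (Option ι → ZMod 2) → Matrix (Fin n) (Fin n) F} (h : IsFrame (2 * ρ) v E)
    (h' : IsFrame ρ (optionCons m v) E') :
    IsHalf ρ E (fun φ => E' (optionCons 1 φ)) ∧ m = ∑ φ, E' (optionCons 1 φ) := by
  have hE : E = _ := (h'.tail.unique h)
  constructor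
  · refine ⟨fun φ => h'.rank _ (optionCons_one_ne_zero φ), fun φ hφ => ?_, ?_⟩
    · rw [hE]
      simp only [if_neg hφ, add_sub_cancel_right]
      exact h'.rank _ (optionCons_ne_zero 0 hφ)
    · have h1 : ∑ φ, E φ + E' (optionCons 1 0) = ∑ φ, E' φ := by
        rw [sum_optionCons, ← Finset.add_sum_erase _ _ (Finset.mem_univ (0 : ι → ZMod 2)),
          ← Finset.add_sum_erase _ (fun φ => E' (optionCons 0 φ) + E' (optionCons 1 φ))
          (Finset.mem_univ (0 : ι → ZMod 2)), h.zero, optionCons_zero, h'.zero, zero_add, zero_add,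
          add_comm]
        congr 1
        refine Finset.sum_congr rfl fun φ hφ => ?_
        rw [hE]
        simp only [if_neg (Finset.ne_of_mem_erase hφ)]
      rw [h1, h'.rank_sum, sum_optionCons, ← h.sum_rank]
      refine Finset.sum_congr rfl fun φ _ => ?_
      rw [h'.rank _ (optionCons_one_ne_zero φ)]
      split_ifs with hφ
      · rw [hφ, optionCons_zero, h'.zero, Matrix.rank_zero, zero_add]
      · rw [h'.rank _ (optionCons_ne_zero 0 hφ), two_mul]
  · have := h'.eq none
    rw [sum_optionCons, optionCons_none] at this
    simpa using this

theorem IsHalf.eq_of_sum_eq {A B : (ι → ZMod 2) → Matrix (Fin n) (Fin n) F}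
    (h : IsFrame (2 * ρ) v E) (hA : IsHalf ρ E A) (hB : IsHalf ρ E B)
    (hAB : ∑ φ, A φ = ∑ φ, B φ) : A = B := by
  have h1 := hA.isFrame h
  rw [hAB] at h1
  have h2 := h1.unique (hB.isFrame h)
  funext φ
  rw [← splitFamily_one E A, ← splitFamily_one E B, h2]

/-- `L₁`, `L₂`, `L₃` split every `E φ` with `φ ≠ 0` into four quarters of rank `ρ`, and their values
at `0` are independent of each other and of `E`. -/
structure IsQuarter (ρ : ℕ) (E L₁ L₂ L₃ : (ι → ZMod 2) → Matrix (Fin n) (Fin n) F) : Prop where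
  rank₁ : ∀ φ, (L₁ φ).rank = ρ
  rank₂ : ∀ φ, (L₂ φ).rank = ρ
  rank₃ : ∀ φ, (L₃ φ).rank = ρ
  sub : ∀ φ, φ ≠ 0 → (E φ - (L₁ φ + L₂ φ + L₃ φ)).rank = ρ
  add : (∑ φ, E φ + (L₁ 0 + L₂ 0 + L₃ 0)).rank = (∑ φ, E φ).rank + 3 * ρ

theorem IsQuarter.swap {L₁ L₂ L₃ : (ι → ZMod 2) → Matrix (Fin n) (Fin n) F}
    (hL : IsQuarter ρ E L₁ L₂ L₃) : IsQuarter ρ E L₁ L₃ L₂ :=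
  ⟨hL.rank₁, hL.rank₃, hL.rank₂, fun φ hφ => by rw [add_right_comm]; exact hL.sub φ hφ, by
    rw [add_right_comm (L₁ 0)]; exact hL.add⟩

/-- Subadditivity of rank bounds each quantity on both sides, and the prescribed total ranks leave
no slack. -/
theorem IsQuarter.isHalf {L₁ L₂ L₃ : (ι → ZMod 2) → Matrix (Fin n) (Fin n) F}
    (h : IsFrame (2 * (2 * ρ)) v E) (hL : IsQuarter ρ E L₁ L₂ L₃) :
    IsHalf (2 * ρ) E fun φ => L₁ φ + L₂ φ := by
  have h1 (φ : ι → ZMod 2) : (L₁ φ + L₂ φ).rank ≤ 2 * ρ := by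
    have := rank_add_le (L₁ φ) (L₂ φ)
    rw [hL.rank₁, hL.rank₂] at this
    omega
  have h2 : (∑ φ, E φ).rank + 2 * ρ ≤ (∑ φ, E φ + (L₁ 0 + L₂ 0)).rank := by
    have h3 := rank_add_le (∑ φ, E φ + (L₁ 0 + L₂ 0)) (L₃ 0)
    rw [add_assoc, hL.add, hL.rank₃] at h3
    omega
  refine ⟨fun φ => le_antisymm (h1 φ) ?_, fun φ hφ => ?_, le_antisymm ?_ h2⟩
  · by_cases hφ : φ = 0
    · have := rank_add_le (∑ φ, E φ) (L₁ 0 + L₂ 0)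
      rw [hφ]
      omega
    · have h3 := rank_add_le (E φ - (L₁ φ + L₂ φ + L₃ φ)) (L₁ φ + L₂ φ + L₃ φ)
      have h4 := rank_add_le (L₁ φ + L₂ φ) (L₃ φ)
      rw [sub_add_cancel, h.rank φ hφ, hL.sub φ hφ] at h3
      rw [hL.rank₃] at h4
      omega
  · have h3 := rank_add_le (E φ - (L₁ φ + L₂ φ)) (L₁ φ + L₂ φ)
    have h4 := rank_add_le (E φ - (L₁ φ + L₂ φ + L₃ φ)) (L₃ φ)
    have h5 := h1 φ
    have h6 : E φ - (L₁ φ + L₂ φ + L₃ φ) + L₃ φ = E φ - (L₁ φ + L₂ φ) := by abel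
    rw [sub_add_cancel, h.rank φ hφ] at h3
    rw [h6, hL.sub φ hφ, hL.rank₃] at h4
    omega
  · have := rank_add_le (∑ φ, E φ) (L₁ 0 + L₂ 0)
    have := h1 0
    omega

/-- Split twice. After the first split the blocks are `L₁ + L₂` and `E - (L₁ + L₂)`; the second
splits them by `L₁` and `L₃`, with `L₃ 0` as its fresh matrix. -/
theorem IsQuarter.exists_isFrame {L₁ L₂ L₃ : (ι → ZMod 2) → Matrix (Fin n) (Fin n) F}
    (h : IsFrame (2 * (2 * ρ)) v E) (hL : IsQuarter ρ E L₁ L₂ L₃) :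
    ∃ E', IsFrame ρ
      (optionCons (∑ φ, (L₁ φ + L₃ φ)) (optionCons (∑ φ, (L₁ φ + L₂ φ)) v)) E' := by
  have hA := hL.isHalf h
  have h1 := hA.isFrame h
  set B : (Option ι → ZMod 2) → Matrix (Fin n) (Fin n) F := fun φ =>
    if φ none = 1 then L₁ fun i => φ (some i) else L₃ fun i => φ (some i)
  have hB0 (φ : ι → ZMod 2) : B (optionCons 0 φ) = L₃ φ := by simp [B]
  have hB1 (φ : ι → ZMod 2) : B (optionCons 1 φ) = L₁ φ := by simp [B]
  have hB : IsHalf ρ (splitFamily E fun φ => L₁ φ + L₂ φ) B := by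
    refine ⟨forall_optionCons (fun φ => by rw [hB0, hL.rank₃]) fun φ => by rw [hB1, hL.rank₁],
      forall_optionCons (fun φ hφ => ?_) fun φ _ => ?_, ?_⟩
    · have : φ ≠ 0 := fun h0 => hφ (h0 ▸ optionCons_zero)
      rw [hB0, splitFamily_zero, if_neg this, sub_sub, hL.sub φ this]
    · rw [hB1, splitFamily_one, add_sub_cancel_left, hL.rank₂]
    · rw [h.sum_splitFamily, ← optionCons_zero, hB0, add_assoc, hL.add, hA.add]
      ring
  have h2 := hB.isFrame h1
  have h3 : ∑ φ, B φ = ∑ φ, (L₁ φ + L₃ φ) := by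
    rw [sum_optionCons]
    exact Finset.sum_congr rfl fun φ _ => by rw [hB0, hB1, add_comm]
  rw [h3] at h2
  exact ⟨_, h2⟩

theorem IsFrame.exists_isQuarter {A A' : (ι → ZMod 2) → Matrix (Fin n) (Fin n) F}
    (h : IsFrame (2 * (2 * ρ)) v E) (hA : IsHalf (2 * ρ) E A) (hA' : IsHalf (2 * ρ) E A')
    {E' : (Option (Option ι) → ZMod 2) → Matrix (Fin n) (Fin n) F}
    (h' : IsFrame ρ (optionCons (∑ φ, A' φ) (optionCons (∑ φ, A φ) v)) E') :
    ∃ L₁ L₂ L₃, IsQuarter ρ E L₁ L₂ L₃ ∧ A = (fun φ => L₁ φ + L₂ φ) ∧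
      A' = fun φ => L₁ φ + L₃ φ := by
  have h1 := hA.isFrame h
  obtain ⟨hB, hs⟩ := h1.isHalf h'
  set B := fun φ => E' (optionCons 1 φ)
  have hQ : IsQuarter ρ E (fun φ => B (optionCons 1 φ)) (fun φ => A φ - B (optionCons 1 φ))
      fun φ => B (optionCons 0 φ) := by
    refine ⟨fun φ => hB.rank _, fun φ => ?_, fun φ => hB.rank _, fun φ hφ => ?_, ?_⟩
    · have := hB.sub _ (optionCons_one_ne_zero φ)
      rwa [splitFamily_one] at this
    · have := hB.sub _ (optionCons_ne_zero 0 hφ)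
      rw [splitFamily_zero, if_neg hφ] at this
      rwa [add_sub_cancel, ← sub_sub]
    · have := hB.add
      rw [h.sum_splitFamily, hA.add, ← optionCons_zero, add_assoc] at this
      rw [add_sub_cancel, this]
      ring
  -- The half family `L₁ + L₃` has the same sum as `A'`, and a half family is determined by its sum.
  refine ⟨_, _, _, hQ, by simp, IsHalf.eq_of_sum_eq h hA' (hQ.swap.isHalf h) ?_⟩
  rw [hs, sum_optionCons]
  exact Finset.sum_congr rfl fun φ _ => add_comm _ _

end Split

/-! ### Faces of the poset and frames -/

section Face

open Matrix

theorem hadamardGenerator_injective (r : ℕ) : Function.Injective (hadamardGenerator r) := by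
  intro k l h
  have hk := k.2
  have hl := l.2
  have hkl : 2 ^ (r + 1) - ((k : ℕ) + 1) = 2 ^ (r + 1) - ((l : ℕ) + 1) := by
    refine Nat.eq_of_testBit_eq fun i => ?_
    by_cases hi : i < r + 1
    · have h1 := congrFun h ⟨r - i, by omega⟩
      have h2 : r - (r - i) = i := by omega
      simp only [hadamardGenerator, h2] at h1
      cases h3 : (2 ^ (r + 1) - ((k : ℕ) + 1)).testBit i <;>
        cases h4 : (2 ^ (r + 1) - ((l : ℕ) + 1)).testBit i <;> simp_all
    · have h3 : 2 ^ (r + 1) ≤ 2 ^ i := Nat.pow_le_pow_right (by norm_num) (by omega)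
      have h4 : 0 < 2 ^ i := by positivity
      rw [Nat.testBit_lt_two_pow (by omega), Nat.testBit_lt_two_pow (by omega)]
  ext
  omega

theorem hadamardGenerator_ne_zero {r : ℕ} (k : Fin (2 ^ (r + 1) - 1)) :
    hadamardGenerator r k ≠ 0 := by
  intro h
  have hk := k.2
  have : 2 ^ (r + 1) - ((k : ℕ) + 1) = 0 := by
    refine Nat.eq_of_testBit_eq fun i => ?_
    rw [Nat.zero_testBit]
    by_cases hi : i < r + 1
    · have h1 := congrFun h ⟨r - i, by omega⟩
      have h2 : r - (r - i) = i := by omega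
      simpa [hadamardGenerator, h2] using h1
    · have h3 : 2 ^ (r + 1) ≤ 2 ^ i := Nat.pow_le_pow_right (by norm_num) (by omega)
      have h4 : 0 < 2 ^ i := by positivity
      exact Nat.testBit_lt_two_pow (by omega)
  omega

theorem card_subtype_ne_zero (ι : Type*) [Fintype ι] [DecidableEq ι] :
    Fintype.card {φ : ι → ZMod 2 // φ ≠ 0} = 2 ^ Fintype.card ι - 1 := by
  rw [Fintype.card_subtype_compl, Fintype.card_fun, ZMod.card, Fintype.card_subtype_eq]

/-- The rows of the generator matrix are the nonzero vectors. -/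
noncomputable def hadamardEquiv (r : ℕ) :
    Fin (2 ^ (r + 1) - 1) ≃ {φ : Fin (r + 1) → ZMod 2 // φ ≠ 0} :=
  Equiv.ofBijective (fun k => ⟨hadamardGenerator r k, hadamardGenerator_ne_zero k⟩) <| by
    rw [Fintype.bijective_iff_injective_and_card]
    refine ⟨fun k l h => hadamardGenerator_injective r (congrArg Subtype.val h), ?_⟩
    rw [card_subtype_ne_zero, Fintype.card_fin, Fintype.card_fin]

theorem sum_subtype_ne_zero {ι M : Type*} [Fintype ι] [DecidableEq ι] [AddCommMonoid M]
    {f : (ι → ZMod 2) → M} (hf : f 0 = 0) :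
    ∑ φ : {φ : ι → ZMod 2 // φ ≠ 0}, f φ = ∑ φ, f φ := by
  rw [← Finset.add_sum_erase _ _ (Finset.mem_univ (0 : ι → ZMod 2)), hf, zero_add]
  exact (Finset.sum_subtype _ (by simp) f).symm

theorem sum_hadamardGenerator {r : ℕ} {M : Type*} [AddCommMonoid M]
    {f : (Fin (r + 1) → ZMod 2) → M} (hf : f 0 = 0) :
    ∑ k, f (hadamardGenerator r k) = ∑ φ, f φ := by
  rw [← sum_subtype_ne_zero hf, ← (hadamardEquiv r).sum_comp]
  rfl

variable {F : Type*} [Field F] [Algebra (ZMod 2) F] {r n : ℕ}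

theorem rank_vecMulVec_eq_one {a b : Fin n → F} (ha : a ≠ 0) (hb : b ≠ 0) :
    (vecMulVec a b).rank = 1 := by
  have := rank_sum_vecMulVec (κ := Unit) (a := fun _ => a) (b := fun _ => b)
    (linearIndependent_unique_iff.mpr ha) (linearIndependent_unique_iff.mpr hb)
  simpa using this

/-- The pure tensors, reindexed by the rows of the generator matrix, are a frame with blocks of rank
one. -/
theorem IsTopFace.exists_isFrame {W : Submodule (ZMod 2) (Matrix (Fin n) (Fin n) F)}
    (hW : IsTopFace F r n W) : ∃ (v : Fin (r + 1) → Matrix (Fin n) (Fin n) F)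
      (E : (Fin (r + 1) → ZMod 2) → Matrix (Fin n) (Fin n) F),
      IsFrame 1 v E ∧ W = Submodule.span (ZMod 2) (Set.range v) := by
  obtain ⟨-, e₁, e₂, h₁, h₂, rfl⟩ := hW
  let E : (Fin (r + 1) → ZMod 2) → Matrix (Fin n) (Fin n) F := fun φ =>
    if h : φ ≠ 0 then vecMulVec (e₁ ((hadamardEquiv r).symm ⟨φ, h⟩))
      (e₂ ((hadamardEquiv r).symm ⟨φ, h⟩)) else 0
  have hE0 : E 0 = 0 := dif_neg (by simp)
  have hE (k : Fin (2 ^ (r + 1) - 1)) :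
      E (hadamardGenerator r k) = vecMulVec (e₁ k) (e₂ k) := by
    have h : (hadamardEquiv r).symm ⟨_, hadamardGenerator_ne_zero k⟩ = k :=
      (hadamardEquiv r).symm_apply_apply k
    simp only [E, dif_pos (hadamardGenerator_ne_zero k), h]
  have hrk (φ : Fin (r + 1) → ZMod 2) (hφ : φ ≠ 0) : (E φ).rank = 1 := by
    obtain ⟨k, hk⟩ := (hadamardEquiv r).surjective ⟨φ, hφ⟩
    have hk : hadamardGenerator r k = φ := congrArg Subtype.val hk
    rw [← hk, hE, rank_vecMulVec_eq_one (h₁.ne_zero k) (h₂.ne_zero k)]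
  refine ⟨_, E, ⟨hE0, exists_isOrthogonalFamily ?_, hrk, fun i => ?_⟩, rfl⟩
  · rw [← sum_hadamardGenerator hE0,
      ← sum_hadamardGenerator (f := fun φ => (E φ).rank) (by rw [hE0, Matrix.rank_zero])]
    simp_rw [hE]
    rw [rank_sum_vecMulVec h₁ h₂, Fintype.card_eq_sum_ones]
    exact Finset.sum_congr rfl fun k _ => by rw [rank_vecMulVec_eq_one (h₁.ne_zero k) (h₂.ne_zero k)]
  · rw [← sum_hadamardGenerator (f := fun φ => φ i • E φ) (by simp)]
    exact Finset.sum_congr rfl fun k _ => by rw [hE]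

/-- Rank-one blocks are pure tensors, and additivity of their ranks makes both families of tensor
factors independent. -/
theorem IsFrame.isTopFace {v : Fin (r + 1) → Matrix (Fin n) (Fin n) F}
    {E : (Fin (r + 1) → ZMod 2) → Matrix (Fin n) (Fin n) F} (h : IsFrame 1 v E) :
    IsTopFace F r n (Submodule.span (ZMod 2) (Set.range v)) := by
  have h1 (k : Fin (2 ^ (r + 1) - 1)) := exists_eq_vecMulVec (h.rank _ (hadamardGenerator_ne_zero k))
  choose e₁ e₂ he using h1
  have h2 : (∑ k, vecMulVec (e₁ k) (e₂ k)).rank = Fintype.card (Fin (2 ^ (r + 1) - 1)) := by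
    simp_rw [← he]
    rw [sum_hadamardGenerator h.zero, h.rank_sum,
      ← sum_hadamardGenerator (f := fun φ => (E φ).rank) (by rw [h.zero, Matrix.rank_zero]),
      Fintype.card_eq_sum_ones]
    exact Finset.sum_congr rfl fun k _ => h.rank _ (hadamardGenerator_ne_zero k)
  obtain ⟨h3, h4⟩ := linearIndependent_of_rank_sum h2
  refine ⟨?_, e₁, e₂, h3, h4, ?_⟩
  · rw [finrank_span_eq_card (h.linearIndependent one_pos), Fintype.card_fin]
  · congr 2
    funext i
    rw [h.eq, ← sum_hadamardGenerator (f := fun φ => φ i • E φ) (by simp)]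
    exact Finset.sum_congr rfl fun k _ => by rw [he]

theorem IsFrame.exists_isHalf {ι : Type*} [Fintype ι] [DecidableEq ι] {ρ : ℕ}
    {v : ι → Matrix (Fin n) (Fin n) F} {E : (ι → ZMod 2) → Matrix (Fin n) (Fin n) F}
    (h : IsFrame (2 * ρ) v E) (hn : 2 ^ Fintype.card ι * (2 * ρ) ≤ n) : ∃ A, IsHalf ρ E A := by
  have h1 (φ : ι → ZMod 2) : ∃ A : Matrix (Fin n) (Fin n) F, A.rank = ρ ∧
      (φ ≠ 0 → (E φ - A).rank = ρ) ∧ (φ = 0 → (∑ φ, E φ + A).rank = (∑ φ, E φ).rank + ρ) := by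
    by_cases hφ : φ = 0
    -- There is room for the fresh matrix: the total rank after splitting is at most `2 ^ card ι *
    -- (2 * ρ) ≤ n`.
    · obtain ⟨B, hB, hB'⟩ := exists_rank_add (∑ φ, E φ) (t := ρ) <| by
        rw [← h.sum_rank]
        refine (Finset.sum_le_card_nsmul _ _ (2 * ρ) fun φ _ => ?_).trans ?_
        · split_ifs <;> omega
        · simpa [ZMod.card] using hn
      exact ⟨B, hB, fun h => absurd hφ h, fun _ => hB'⟩
    · obtain ⟨A, hA, hA'⟩ := exists_rank_sub (E φ) (t := ρ) (by rw [h.rank φ hφ]; omega)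
      refine ⟨A, hA, fun _ => ?_, fun h => absurd h hφ⟩
      rw [hA', h.rank φ hφ]
      omega
  choose A hA hA' hA'' using h1
  exact ⟨A, hA, hA', hA'' 0 rfl⟩

/-- Halve the blocks `d` times until they have rank one; each halving adds one vector. -/
theorem IsFrame.exists_isTopFace (hn : 2 ^ (r + 1) ≤ n) {d : ℕ} {ι : Type} [Fintype ι]
    [DecidableEq ι] (hd : Fintype.card ι + d = r + 1) {v : ι → Matrix (Fin n) (Fin n) F}
    {E : (ι → ZMod 2) → Matrix (Fin n) (Fin n) F} (h : IsFrame (2 ^ d) v E) :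
    ∃ W, IsTopFace F r n W ∧ Submodule.span (ZMod 2) (Set.range v) ≤ W := by
  induction d generalizing ι with
  | zero =>
    let e : Fin (r + 1) ≃ ι := (Fintype.equivFinOfCardEq hd).symm
    obtain ⟨E', hE'⟩ := h.exists_of_mem_span (w := v ∘ e) (ρ' := 1)
      ((h.linearIndependent one_pos).comp e e.injective)
      (fun j => Submodule.subset_span ⟨e j, rfl⟩) (by
        rw [Fintype.card_congr e, pow_zero])
    refine ⟨_, hE'.isTopFace, ?_⟩
    rw [Set.range_comp, e.range_eq_univ, Set.image_univ]
  | succ d ih =>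
    rw [pow_succ'] at h
    obtain ⟨A, hA⟩ := h.exists_isHalf (by
      rw [← pow_succ', ← pow_add, hd]; exact hn)
    obtain ⟨W, hW, hle⟩ := ih (ι := Option ι) (by rw [Fintype.card_option]; omega) (hA.isFrame h)
    refine ⟨W, hW, le_trans (Submodule.span_mono ?_) hle⟩
    rintro _ ⟨i, rfl⟩
    exact ⟨some i, rfl⟩

theorem IsTopFace.exists_isFrame_of_mem {W : Submodule (ZMod 2) (Matrix (Fin n) (Fin n) F)}
    (hW : IsTopFace F r n W) {d : ℕ} {ι : Type*} [Fintype ι] [DecidableEq ι]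
    (hd : Fintype.card ι + d = r + 1) {v : ι → Matrix (Fin n) (Fin n) F}
    (hv : LinearIndependent (ZMod 2) v) (hmem : ∀ i, v i ∈ W) : ∃ E, IsFrame (2 ^ d) v E := by
  obtain ⟨u, E, hE, rfl⟩ := hW.exists_isFrame
  refine hE.exists_of_mem_span hv hmem ?_
  rw [one_mul, Fintype.card_fin, ← hd, pow_add, mul_comm]

end Face

/-! ### Half families as vertices of the tensor product of the walks -/

section Encoding

open Matrix

variable {F : Type*} [Field F] {n : ℕ}

theorem rankLT_one_iff {m t : ℕ} (ht : 0 < t) {M : Matrix (Fin m) (Fin m) F} (hM : M.rank + t = m) :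
    RankLT M 1 ↔ (1 - M).rank = t := by
  unfold RankLT RankLE
  rw [Matrix.rank_one, Fintype.card_fin]
  constructor
  · rintro ⟨h, -⟩
    omega
  · intro h
    refine ⟨by omega, ?_⟩
    rintro rfl
    rw [sub_self, Matrix.rank_zero] at h
    omega

section Factorization

variable {m : ℕ} {U : Matrix (Fin n) (Fin m) F} {V : Matrix (Fin m) (Fin n) F}
  {U' : Matrix (Fin m) (Fin n) F} {V' : Matrix (Fin n) (Fin m) F}

theorem mul_mul_cancel (hU : U' * U = 1) (hV : V * V' = 1) (M : Matrix (Fin m) (Fin m) F) :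
    U' * (U * M * V) * V' = M := by
  rw [Matrix.mul_assoc, Matrix.mul_assoc (U * M), hV, Matrix.mul_one, ← Matrix.mul_assoc, hU,
    Matrix.one_mul]

theorem rank_mul_mul (hU : U' * U = 1) (hV : V * V' = 1) (M : Matrix (Fin m) (Fin m) F) :
    (U * M * V).rank = M.rank := by
  refine le_antisymm ((rank_mul_le_left _ _).trans (rank_mul_le_right _ _)) ?_
  conv_lhs => rw [← mul_mul_cancel hU hV M]
  exact (rank_mul_le_left _ _).trans (rank_mul_le_right _ _)

/-- If `A` lies below `S = U * V` in the rank order and `T` is a generalized inverse of `S`, then `A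
= S * T * A * T * S`. -/
theorem exists_eq_mul_mul {A : Matrix (Fin n) (Fin n) F}
    (hA : A.rank + (U * V - A).rank ≤ (U * V).rank) :
    ∃ M : Matrix (Fin m) (Fin m) F, A = U * M * V := by
  obtain ⟨T, hT⟩ := exists_mul_mul_eq_self (U * V)
  have h := orthogonal_of_rank_add (A := A) (C := U * V - A) (T := T)
    (le_antisymm (rank_add_le _ _) (by rwa [add_sub_cancel])) (by rwa [add_sub_cancel])
  obtain ⟨h1, h2, h3, -⟩ := h
  rw [Matrix.sub_mul, Matrix.sub_mul, h1, sub_eq_zero] at h2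
  rw [Matrix.mul_sub, h1, sub_eq_zero] at h3
  refine ⟨V * T * A * T * U, ?_⟩
  calc A = U * V * T * A := h2.symm
    _ = U * V * T * (A * T * (U * V)) := by rw [h3]
    _ = _ := by simp only [Matrix.mul_assoc]

end Factorization

/-- With `E = U * V` of full inner rank, `M ↦ U * M * V` preserves ranks, takes `1` to `E`, and
reaches everything below `E`. -/
theorem exists_encoding_walk₁ {E : Matrix (Fin n) (Fin n) F} {s : ℕ} (hE : E.rank = 2 ^ (s + 2)) :
    ∃ f : Vertex₁ F s → Matrix (Fin n) (Fin n) F, Function.Injective f ∧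
      (∀ a, (f a).rank = 2 * 2 ^ s ∧ (E - f a).rank = 2 * 2 ^ s) ∧
      (∀ B : Matrix (Fin n) (Fin n) F, B.rank = 2 * 2 ^ s → (E - B).rank = 2 * 2 ^ s →
        ∃ a, f a = B) ∧
      ∀ c a b, (walk₁ F s c).Adj a b ↔ ∃ L₁ L₂ L₃ : Matrix (Fin n) (Fin n) F,
        L₁.rank = 2 ^ s ∧ L₂.rank = 2 ^ s ∧ L₃.rank = 2 ^ s ∧
        (E - (L₁ + L₂ + L₃)).rank = 2 ^ s ∧ f a = L₁ + L₂ ∧ f b = L₁ + L₃ := by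
  obtain ⟨U, V, U', V', hU, hV, rfl⟩ := exists_rank_factorization hE
  have hq : 0 < 2 ^ s := by positivity
  have hs1 : 2 ^ (s + 1) = 2 * 2 ^ s := pow_succ' _ _
  have hs2 : 2 ^ (s + 2) = 4 * 2 ^ s := by rw [pow_add]; ring
  have hsub (M : Matrix (Fin (2 ^ (s + 2))) (Fin (2 ^ (s + 2))) F) :
      U * V - U * M * V = U * (1 - M) * V := by
    rw [Matrix.mul_sub, Matrix.sub_mul, Matrix.mul_one]
  have hinj {M N : Matrix (Fin (2 ^ (s + 2))) (Fin (2 ^ (s + 2))) F}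
      (h : U * M * V = U * N * V) : M = N := by
    rw [← mul_mul_cancel hU hV M, h, mul_mul_cancel hU hV]
  refine ⟨fun a => U * a.1 * V, fun a b hab => Subtype.ext (hinj hab), fun a => ⟨?_, ?_⟩,
    fun B hB hB' => ?_, fun c a b => ⟨?_, ?_⟩⟩
  · rw [rank_mul_mul hU hV, a.2.1, hs1]
  · rw [hsub, rank_mul_mul hU hV]
    exact (rankLT_one_iff (by omega) (by rw [a.2.1]; omega)).mp a.2.2
  · obtain ⟨M, rfl⟩ := exists_eq_mul_mul (U := U) (V := V) (A := B) (by omega)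
    rw [hsub, rank_mul_mul hU hV] at hB'
    rw [rank_mul_mul hU hV] at hB
    exact ⟨⟨M, by omega, (rankLT_one_iff (by omega) (by omega)).mpr hB'⟩, rfl⟩
  · rintro ⟨L₁, L₂, L₃, h1, h2, h3, h4, h5, ha, hb⟩
    refine ⟨U * L₁ * V, U * L₂ * V, U * L₃ * V, ?_, ?_, ?_, ?_, ?_, ?_⟩
    · rw [rank_mul_mul hU hV, h1]
    · rw [rank_mul_mul hU hV, h2]
    · rw [rank_mul_mul hU hV, h3]
    · rw [← Matrix.add_mul, ← Matrix.mul_add, ← Matrix.add_mul, ← Matrix.mul_add, hsub,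
        rank_mul_mul hU hV]
      exact (rankLT_one_iff hq (by omega)).mp h5
    · beta_reduce
      rw [ha, ← Matrix.add_mul, ← Matrix.mul_add]
    · beta_reduce
      rw [hb, ← Matrix.add_mul, ← Matrix.mul_add]
  · rintro ⟨L₁, L₂, L₃, h1, h2, h3, h4, ha, hb⟩
    beta_reduce at ha hb
    -- Only `L₁` has to be shown to lie below `U * V`; the other two are differences of it with the
    -- encoded endpoints.
    obtain ⟨M, rfl⟩ := exists_eq_mul_mul (U := U) (V := V) (A := L₁) (by
      have e : U * V - L₁ = U * V - (L₁ + L₂ + L₃) + (L₂ + L₃) := by abel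
      have := rank_add_le (U * V - (L₁ + L₂ + L₃)) (L₂ + L₃)
      have := rank_add_le L₂ L₃
      rw [e]
      omega)
    obtain rfl : L₂ = U * (a.1 - M) * V := by
      rw [Matrix.mul_sub, Matrix.sub_mul, ha, add_sub_cancel_left]
    obtain rfl : L₃ = U * (b.1 - M) * V := by
      rw [Matrix.mul_sub, Matrix.sub_mul, hb, add_sub_cancel_left]
    rw [← Matrix.add_mul, ← Matrix.mul_add, ← Matrix.add_mul, ← Matrix.mul_add, hsub] at h4
    rw [rank_mul_mul hU hV] at h1 h2 h3 h4
    have h5 := rank_add_le (1 - (M + (a.1 - M) + (b.1 - M))) (M + (a.1 - M) + (b.1 - M))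
    have h6 := rank_add_le (M + (a.1 - M)) (b.1 - M)
    have h7 := rank_add_le M (a.1 - M)
    rw [sub_add_cancel, Matrix.rank_one, Fintype.card_fin] at h5
    refine ⟨M, a.1 - M, b.1 - M, h1, h2, h3, ?_, ?_, by simp, by simp⟩
    · omega
    · exact (rankLT_one_iff hq (by omega)).mpr h4

/-- Only the rank of `S` matters: it is equivalent to a matrix `S₀` with row span `R` and column
span `C`, and `M ↦ g * M * k` carries independence from `S₀` to independence from `S`. -/
theorem exists_encoding_walk₂ {S : Matrix (Fin n) (Fin n) F} {s : ℕ}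
    {R C : Submodule F (Fin n → F)} (hR : Module.finrank F R = S.rank)
    (hC : Module.finrank F C = S.rank) :
    ∃ f : Vertex₂ s n R C → Matrix (Fin n) (Fin n) F, Function.Injective f ∧
      (∀ a, (f a).rank = 2 * 2 ^ s ∧ (S + f a).rank = S.rank + 2 * 2 ^ s) ∧
      (∀ B : Matrix (Fin n) (Fin n) F, B.rank = 2 * 2 ^ s → (S + B).rank = S.rank + 2 * 2 ^ s →
        ∃ a, f a = B) ∧
      ∀ c a b, (walk₂ s n R C c).Adj a b ↔ ∃ L₁ L₂ L₃ : Matrix (Fin n) (Fin n) F,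
        L₁.rank = 2 ^ s ∧ L₂.rank = 2 ^ s ∧ L₃.rank = 2 ^ s ∧
        (S + (L₁ + L₂ + L₃)).rank = S.rank + 3 * 2 ^ s ∧ f a = L₁ + L₂ ∧ f b = L₁ + L₃ := by
  obtain ⟨S₀, hS₀, rfl, rfl⟩ := exists_rowSpan_colSpan hR hC
  obtain ⟨g, k, hg, hk, hS⟩ := exists_isUnit_mul_mul_eq hS₀.symm
  have hs1 : 2 ^ (s + 1) = 2 * 2 ^ s := pow_succ' _ _
  have hadd (M : Matrix (Fin n) (Fin n) F) : (S + g * M * k).rank = (S₀ + M).rank := by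
    conv_lhs => rw [hS]
    rw [← Matrix.add_mul, ← Matrix.mul_add, rank_isUnit_mul_mul hg hk]
  have hinj {M N : Matrix (Fin n) (Fin n) F} (h : g * M * k = g * N * k) : M = N :=
    hg.mul_left_cancel (hk.mul_right_cancel h)
  have hsurj (B : Matrix (Fin n) (Fin n) F) : ∃ M, B = g * M * k := by
    obtain ⟨g', hg'⟩ := hg.exists_right_inv
    obtain ⟨k', hk'⟩ := hk.exists_left_inv
    refine ⟨g' * B * k', ?_⟩
    rw [Matrix.mul_assoc, Matrix.mul_assoc, hk', Matrix.mul_one, ← Matrix.mul_assoc, hg',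
      Matrix.one_mul]
  refine ⟨fun a => g * a.1 * k, fun a b hab => Subtype.ext (hinj hab), fun a => ⟨?_, ?_⟩,
    fun B hB hB' => ?_, fun c a b => ⟨?_, ?_⟩⟩
  · rw [rank_isUnit_mul_mul hg hk, a.2.1, hs1]
  · rw [hadd, (rank_add_iff _ _).mpr a.2.2, a.2.1, hS₀, hs1]
  · obtain ⟨M, rfl⟩ := hsurj B
    rw [rank_isUnit_mul_mul hg hk] at hB
    rw [hadd, ← hS₀, ← hB] at hB'
    exact ⟨⟨M, by omega, (rank_add_iff _ _).mp hB'⟩, rfl⟩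
  · rintro ⟨L₁, L₂, L₃, h1, h2, h3, h4, h5, h6, ha, hb⟩
    refine ⟨g * L₁ * k, g * L₂ * k, g * L₃ * k, ?_, ?_, ?_, ?_, ?_, ?_⟩
    · rw [rank_isUnit_mul_mul hg hk, h1]
    · rw [rank_isUnit_mul_mul hg hk, h2]
    · rw [rank_isUnit_mul_mul hg hk, h3]
    · rw [← Matrix.add_mul, ← Matrix.mul_add, ← Matrix.add_mul, ← Matrix.mul_add, hadd,
        (rank_add_iff _ _).mpr ⟨h5, h6⟩, h4, hS₀]
    · beta_reduce
      rw [ha, ← Matrix.add_mul, ← Matrix.mul_add]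
    · beta_reduce
      rw [hb, ← Matrix.add_mul, ← Matrix.mul_add]
  · rintro ⟨L₁, L₂, L₃, h1, h2, h3, h4, ha, hb⟩
    obtain ⟨L₁, rfl⟩ := hsurj L₁
    obtain ⟨L₂, rfl⟩ := hsurj L₂
    obtain ⟨L₃, rfl⟩ := hsurj L₃
    rw [← Matrix.add_mul, ← Matrix.mul_add] at ha hb h4
    rw [← Matrix.add_mul, ← Matrix.mul_add, hadd] at h4
    rw [rank_isUnit_mul_mul hg hk] at h1 h2 h3
    have h5 := rank_add_le S₀ (L₁ + L₂ + L₃)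
    have h6 := rank_add_le (L₁ + L₂) L₃
    have h7 := rank_add_le L₁ L₂
    have h8 : (L₁ + L₂ + L₃).rank = 3 * 2 ^ s := by omega
    obtain ⟨h9, h10⟩ := (rank_add_iff S₀ (L₁ + L₂ + L₃)).mp (by rw [h4, h8, hS₀])
    exact ⟨L₁, L₂, L₃, h1, h2, h3, h8, h9, h10, hinj ha, hinj hb⟩

variable [Algebra (ZMod 2) F] {ι : Type*} [Fintype ι] [DecidableEq ι]

/-- The conditions on a half or quarter family are imposed on each functional separately: the `2 ^
card ι - 1` nonzero ones give the copies of `walk₁`, and `0` gives `walk₂`. -/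
theorem IsFrame.exists_encoding {v : ι → Matrix (Fin n) (Fin n) F}
    {E : (ι → ZMod 2) → Matrix (Fin n) (Fin n) F} {s N : ℕ}
    (h : IsFrame (2 * (2 * 2 ^ s)) v E) {R C : Submodule F (Fin n → F)}
    (hR : Module.finrank F R = (∑ φ, E φ).rank) (hC : Module.finrank F C = (∑ φ, E φ).rank)
    (hN : N = 2 ^ Fintype.card ι - 1) :
    ∃ A : (Fin N → Vertex₁ F s) × Vertex₂ s n R C → (ι → ZMod 2) → Matrix (Fin n) (Fin n) F,
      Function.Injective A ∧ (∀ a, IsHalf (2 * 2 ^ s) E (A a)) ∧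
      (∀ B, IsHalf (2 * 2 ^ s) E B → ∃ a, A a = B) ∧
      ∀ c₁ c₂ a b, (((walk₁ F s c₁).tensorPow N).tensor (walk₂ s n R C c₂)).Adj a b ↔
        ∃ L₁ L₂ L₃, IsQuarter (2 ^ s) E L₁ L₂ L₃ ∧ (A a = fun φ => L₁ φ + L₂ φ) ∧
          A b = fun φ => L₁ φ + L₃ φ := by
  have σ : Fin N ≃ {φ : ι → ZMod 2 // φ ≠ 0} :=
    (Fintype.equivFinOfCardEq ((card_subtype_ne_zero ι).trans hN.symm)).symm
  have h1 (j : Fin N) := exists_encoding_walk₁ (E := E (σ j).1) (s := s)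
    (by rw [h.rank _ (σ j).2, pow_add]; ring)
  choose f hf hfr hfs hfa using h1
  obtain ⟨f', hf', hfr', hfs', hfa'⟩ := exists_encoding_walk₂ (s := s) hR hC
  obtain ⟨dec, dec0, dec1⟩ : ∃ dec : (Fin N → Matrix (Fin n) (Fin n) F) →
      Matrix (Fin n) (Fin n) F → (ι → ZMod 2) → Matrix (Fin n) (Fin n) F,
      (∀ B B', dec B B' 0 = B') ∧ ∀ B B' j, dec B B' (σ j).1 = B j := by
    refine ⟨fun B B' φ => if hφ : φ ≠ 0 then B (σ.symm ⟨φ, hφ⟩) else B',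
      fun B B' => dif_neg (by simp), fun B B' j => ?_⟩
    simp only [dif_pos (σ j).2, Subtype.coe_eta, Equiv.symm_apply_apply]
  have cases {p : (ι → ZMod 2) → Prop} (p0 : p 0) (p1 : ∀ j, p (σ j).1) (φ) : p φ := by
    by_cases hφ : φ = 0
    · rwa [hφ]
    · have := p1 (σ.symm ⟨φ, hφ⟩)
      rwa [Equiv.apply_symm_apply] at this
  have cases' {p : (ι → ZMod 2) → Prop} (p1 : ∀ j, p (σ j).1) (φ) (hφ : φ ≠ 0) : p φ := by
    have := p1 (σ.symm ⟨φ, hφ⟩)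
    rwa [Equiv.apply_symm_apply] at this
  refine ⟨fun a => dec (fun j => f j (a.1 j)) (f' a.2), fun a b hab => ?_, fun a => ⟨?_, ?_, ?_⟩,
    fun B hB => ?_, fun c₁ c₂ a b => ⟨?_, ?_⟩⟩
  · refine Prod.ext (funext fun j => hf j ?_) (hf' ?_)
    · have := congrFun hab (σ j).1
      simpa only [dec1] using this
    · have := congrFun hab 0
      simpa only [dec0] using this
  · refine cases ?_ fun j => ?_
    · beta_reduce
      rw [dec0, (hfr' _).1]
    · beta_reduce
      rw [dec1, (hfr _ _).1]
  · refine cases' fun j => ?_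
    beta_reduce
    rw [dec1, (hfr _ _).2]
  · beta_reduce
    rw [dec0, (hfr' _).2]
  · have h2 (j : Fin N) := hfs j (B (σ j).1) (hB.rank _) (hB.sub _ (σ j).2)
    choose a ha using h2
    obtain ⟨a', ha'⟩ := hfs' (B 0) (hB.rank 0) hB.add
    refine ⟨(a, a'), funext (cases ?_ fun j => ?_)⟩
    · beta_reduce
      rw [dec0, ha']
    · beta_reduce
      rw [dec1, ha]
  · rintro ⟨h2, h3⟩
    have h2 (j : Fin N) := (hfa j c₁ _ _).mp (h2 j)
    choose L₁ L₂ L₃ hL using h2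
    obtain ⟨M₁, M₂, M₃, hM⟩ := (hfa' c₂ _ _).mp h3
    refine ⟨dec L₁ M₁, dec L₂ M₂, dec L₃ M₃, ⟨cases ?_ fun j => ?_, cases ?_ fun j => ?_,
      cases ?_ fun j => ?_, cases' fun j => ?_, ?_⟩, funext (cases ?_ fun j => ?_),
      funext (cases ?_ fun j => ?_)⟩
    all_goals simp only [dec0, dec1]
    exacts [hM.1, (hL j).1, hM.2.1, (hL j).2.1, hM.2.2.1, (hL j).2.2.1, (hL j).2.2.2.1, hM.2.2.2.1,
      hM.2.2.2.2.1, (hL j).2.2.2.2.1, hM.2.2.2.2.2, (hL j).2.2.2.2.2]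
  · rintro ⟨L₁, L₂, L₃, hL, ha, hb⟩
    refine ⟨fun j => (hfa j c₁ _ _).mpr ⟨L₁ (σ j).1, L₂ (σ j).1, L₃ (σ j).1, hL.rank₁ _, hL.rank₂ _,
      hL.rank₃ _, hL.sub _ (σ j).2, ?_, ?_⟩, (hfa' c₂ _ _).mpr ⟨L₁ 0, L₂ 0, L₃ 0, hL.rank₁ _,
      hL.rank₂ _, hL.rank₃ _, hL.add, ?_, ?_⟩⟩
    · simpa only [dec1] using congrFun ha (σ j).1
    · simpa only [dec1] using congrFun hb (σ j).1
    · simpa only [dec0] using congrFun ha 0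
    · simpa only [dec0] using congrFun hb 0

theorem weight_tensor_walk (s N : ℕ) (R C : Submodule F (Fin n → F)) (c₁ c₂ : ℝ≥0)
    (a b : (Fin N → Vertex₁ F s) × Vertex₂ s n R C)
    [Decidable ((((walk₁ F s c₁).tensorPow N).tensor (walk₂ s n R C c₂)).Adj a b)] :
    (((walk₁ F s c₁).tensorPow N).tensor (walk₂ s n R C c₂)).weight a b =
      if (((walk₁ F s c₁).tensorPow N).tensor (walk₂ s n R C c₂)).Adj a b then c₁ ^ N * c₂
      else 0 := by
  split_ifs with h
  · have h1 : ∀ j ∈ Finset.univ, (walk₁ F s c₁).weight (a.1 j) (b.1 j) = c₁ :=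
      fun j _ => if_pos (h.1 j)
    have h2 : (walk₂ s n R C c₂).weight a.2 b.2 = c₂ := if_pos h.2
    change (∏ j, (walk₁ F s c₁).weight (a.1 j) (b.1 j)) * (walk₂ s n R C c₂).weight a.2 b.2 = _
    rw [Finset.prod_congr rfl h1, h2, Finset.prod_const, Finset.card_univ, Fintype.card_fin]
  · exact WeightedGraph.weight_eq_zero _ _ _ h

end Encoding

/-! ### Weights in the link and the projection -/

section Projection

open Matrix

theorem finsum_mem_const_nnreal {α : Type*} [Finite α] (s : Set α) (c : ℝ≥0) :
    ∑ᶠ a ∈ s, c = s.ncard * c := by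
  rw [finsum_mem_eq_finite_toFinset_sum _ s.toFinite, Finset.sum_const, nsmul_eq_mul,
    Set.ncard_eq_toFinset_card s s.toFinite]

variable {F : Type*} [Field F] [Algebra (ZMod 2) F] {r n : ℕ}

theorem IsFrame.rank_sum_univ {ι : Type*} [Fintype ι] [DecidableEq ι] {ρ : ℕ}
    {v : ι → Matrix (Fin n) (Fin n) F} {E : (ι → ZMod 2) → Matrix (Fin n) (Fin n) F}
    (h : IsFrame ρ v E) : (∑ φ, E φ).rank = (2 ^ Fintype.card ι - 1) * ρ := by
  rw [← Finset.add_sum_erase _ _ (Finset.mem_univ (0 : ι → ZMod 2)), h.zero, zero_add, h.rank_sum,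
    Finset.sum_congr rfl fun φ hφ => h.rank φ (Finset.ne_of_mem_erase hφ), Finset.sum_const,
    Finset.card_erase_of_mem (Finset.mem_univ _), Finset.card_univ, Fintype.card_fun, ZMod.card,
    smul_eq_mul]

theorem span_range_optionCons {ι : Type*} [Fintype ι] [DecidableEq ι]
    (m : Matrix (Fin n) (Fin n) F) (v : ι → Matrix (Fin n) (Fin n) F) :
    Submodule.span (ZMod 2) (Set.range (optionCons m v)) =
      Submodule.span (ZMod 2) (Set.range v) ⊔ Submodule.span (ZMod 2) {m} := by
  rw [← Submodule.span_union]
  congr 1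
  ext M
  constructor
  · rintro ⟨_ | i, rfl⟩
    · exact Or.inr rfl
    · exact Or.inl ⟨i, rfl⟩
  · rintro (⟨i, rfl⟩ | rfl)
    · exact ⟨some i, rfl⟩
    · exact ⟨none, rfl⟩

theorem linearIndependent_optionCons {ι : Type*} [Fintype ι] [DecidableEq ι]
    {m : Matrix (Fin n) (Fin n) F} {v : ι → Matrix (Fin n) (Fin n) F} :
    LinearIndependent (ZMod 2) (optionCons m v) ↔
      LinearIndependent (ZMod 2) v ∧ m ∉ Submodule.span (ZMod 2) (Set.range v) :=
  linearIndependent_option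

theorem lowRankPoset_weight_eq {y z : Face F r n}
    (h : Module.finrank (ZMod 2) y.1 = Module.finrank (ZMod 2) z.1) :
    (lowRankPoset F r n).weight y = (lowRankPoset F r n).weight z := by
  simp only [lowRankPoset, h]

theorem lowRankPoset_rank_eq_iff {y z : Face F r n} :
    (lowRankPoset F r n).rank y = (lowRankPoset F r n).rank z ↔
      Module.finrank (ZMod 2) y.1 = Module.finrank (ZMod 2) z.1 := by
  simp only [lowRankPoset]
  omega

theorem lowRankPoset_weight_pos [Finite F] (y : Face F r n) :
    0 < (lowRankPoset F r n).weight y := by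
  have : Finite (Submodule (ZMod 2) (Matrix (Fin n) (Fin n) F)) :=
    Finite.of_injective _ SetLike.coe_injective
  have : Nonempty {z : Face F r n //
    Module.finrank (ZMod 2) z.1 = Module.finrank (ZMod 2) y.1} := ⟨⟨y, rfl⟩⟩
  have : 0 < Nat.card {z : Face F r n //
    Module.finrank (ZMod 2) z.1 = Module.finrank (ZMod 2) y.1} := Nat.card_pos
  exact one_div_pos.mpr (by exact_mod_cast this)

theorem link_rank_eq_iff {x : Face F r n} {k : ℕ} (hx : Module.finrank (ZMod 2) x.1 = k)
    (y : {y : Face F r n // x ≤ y}) (j : ℕ) :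
    ((lowRankPoset F r n).link x).rank y = j ↔ Module.finrank (ZMod 2) y.1.1 = k + 1 + j := by
  simp only [lowRankPoset, RankedWeights.link, hx]
  omega

theorem link_weight_eq {x : Face F r n} {y z : {y : Face F r n // x ≤ y}}
    (h : Module.finrank (ZMod 2) y.1.1 = Module.finrank (ZMod 2) z.1.1) :
    ((lowRankPoset F r n).link x).weight y = ((lowRankPoset F r n).link x).weight z := by
  simp only [RankedWeights.link, lowRankPoset_weight_eq h, lowRankPoset_rank_eq_iff.mpr h]

theorem link_weight_pos [Finite F] {x : Face F r n} (y : {y : Face F r n // x ≤ y}) :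
    0 < ((lowRankPoset F r n).link x).weight y := by
  have : Finite (Submodule (ZMod 2) (Matrix (Fin n) (Fin n) F)) :=
    Finite.of_injective _ SetLike.coe_injective
  refine div_pos (lowRankPoset_weight_pos _) ?_
  -- The normalizing sum is finite and contains the weight of `y` itself.
  let f : {y : Face F r n // x ≤ y} → ℝ≥0 := fun z =>
    ∑ᶠ _ : (lowRankPoset F r n).rank z.1 = (lowRankPoset F r n).rank y.1,
      (lowRankPoset F r n).weight z.1
  have h1 : f y = (lowRankPoset F r n).weight y.1 := by simp [f]
  have h2 : f y ≤ ∑ᶠ z, f z := single_le_finsum y (Set.toFinite _) fun _ => zero_le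
  exact (h1 ▸ lowRankPoset_weight_pos y.1).trans_le h2

section Link

variable {k s : ℕ} {x : Face F r n} {v : Fin k → Matrix (Fin n) (Fin n) F}

/-- Together with `IsFrame.span_optionCons`: for `m` outside `x`, adjoining `m` gives a face exactly
when the extended basis has a frame with blocks of rank `2 * 2 ^ s`. -/
theorem exists_isFrame_optionCons (hks : k + (s + 2) = r + 1)
    (hv : LinearIndependent (ZMod 2) v) (hvx : Submodule.span (ZMod 2) (Set.range v) = x.1)
    {y : Face F r n} (hxy : x ≤ y) {m : Matrix (Fin n) (Fin n) F} (hm : m ∈ y.1) (hmx : m ∉ x.1) :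
    ∃ E, IsFrame (2 * 2 ^ s) (optionCons m v) E := by
  obtain ⟨W, hW, hyW⟩ := y.2
  rw [← pow_succ']
  refine hW.exists_isFrame_of_mem (by rw [Fintype.card_option, Fintype.card_fin]; omega)
    (linearIndependent_optionCons.mpr ⟨hv, hvx ▸ hmx⟩) ?_
  rintro (_ | i)
  · exact hyW hm
  · exact hyW (hxy (hvx ▸ Submodule.subset_span ⟨i, rfl⟩))

theorem IsFrame.span_optionCons (hn : 2 ^ (r + 1) ≤ n) (hks : k + (s + 2) = r + 1)
    (hvx : Submodule.span (ZMod 2) (Set.range v) = x.1) {m : Matrix (Fin n) (Fin n) F}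
    {E : (Option (Fin k) → ZMod 2) → Matrix (Fin n) (Fin n) F}
    (h : IsFrame (2 * 2 ^ s) (optionCons m v) E) :
    (∃ W, IsTopFace F r n W ∧ x.1 ⊔ Submodule.span (ZMod 2) {m} ≤ W) ∧
      Module.finrank (ZMod 2) (x.1 ⊔ Submodule.span (ZMod 2) {m} : Submodule _ _) = k + 1 ∧
      m ∉ x.1 := by
  have hli := h.linearIndependent (by positivity)
  rw [← pow_succ'] at h
  have h1 := h.exists_isTopFace hn (by rw [Fintype.card_option, Fintype.card_fin]; omega)
  have h2 := finrank_span_eq_card hli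
  rw [span_range_optionCons, hvx] at h1 h2
  rw [Fintype.card_option, Fintype.card_fin] at h2
  exact ⟨h1, h2, hvx ▸ (linearIndependent_optionCons.mp hli).2⟩

theorem exists_isFrame_optionCons_optionCons (hks : k + (s + 2) = r + 1)
    (hv : LinearIndependent (ZMod 2) v) (hvx : Submodule.span (ZMod 2) (Set.range v) = x.1)
    {z : Face F r n} (hxz : x ≤ z) {m m' : Matrix (Fin n) (Fin n) F} (hm : m ∈ z.1) (hmx : m ∉ x.1)
    (hm' : m' ∈ z.1) (hmx' : m' ∉ x.1 ⊔ Submodule.span (ZMod 2) {m}) :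
    ∃ E, IsFrame (2 ^ s) (optionCons m' (optionCons m v)) E := by
  obtain ⟨W, hW, hzW⟩ := z.2
  refine hW.exists_isFrame_of_mem
    (by rw [Fintype.card_option, Fintype.card_option, Fintype.card_fin]; omega)
    (linearIndependent_optionCons.mpr ⟨linearIndependent_optionCons.mpr ⟨hv, hvx ▸ hmx⟩, ?_⟩) ?_
  · rwa [span_range_optionCons, hvx]
  · rintro (_ | _ | i)
    · exact hzW hm'
    · exact hzW hm
    · exact hzW (hxz (hvx ▸ Submodule.subset_span ⟨i, rfl⟩))

theorem IsFrame.span_optionCons_optionCons (hn : 2 ^ (r + 1) ≤ n) (hks : k + (s + 2) = r + 1)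
    (hvx : Submodule.span (ZMod 2) (Set.range v) = x.1) {m m' : Matrix (Fin n) (Fin n) F}
    {E : (Option (Option (Fin k)) → ZMod 2) → Matrix (Fin n) (Fin n) F}
    (h : IsFrame (2 ^ s) (optionCons m' (optionCons m v)) E) :
    (∃ W, IsTopFace F r n W ∧
      x.1 ⊔ Submodule.span (ZMod 2) {m} ⊔ Submodule.span (ZMod 2) {m'} ≤ W) ∧
      Module.finrank (ZMod 2) (x.1 ⊔ Submodule.span (ZMod 2) {m} ⊔ Submodule.span (ZMod 2) {m'} :
        Submodule _ _) = k + 2 ∧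
      m' ∉ x.1 ⊔ Submodule.span (ZMod 2) {m} := by
  have hli := h.linearIndependent (by positivity)
  have h1 := h.exists_isTopFace hn
    (by rw [Fintype.card_option, Fintype.card_option, Fintype.card_fin]; omega)
  have h2 := finrank_span_eq_card hli
  have h3 := (linearIndependent_optionCons.mp hli).2
  rw [span_range_optionCons, span_range_optionCons, hvx] at h1 h2
  rw [span_range_optionCons, hvx] at h3
  rw [Fintype.card_option, Fintype.card_option, Fintype.card_fin] at h2
  exact ⟨h1, h2, h3⟩

end Link

theorem ncard_sdiff [Finite F] {x y : Submodule (ZMod 2) (Matrix (Fin n) (Fin n) F)} (hxy : x ≤ y)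
    {k : ℕ} (hx : Module.finrank (ZMod 2) x = k) (hy : Module.finrank (ZMod 2) y = k + 1) :
    ((y : Set (Matrix (Fin n) (Fin n) F)) \ x).ncard = 2 ^ k := by
  have : Finite (Matrix (Fin n) (Fin n) F) := inferInstanceAs (Finite (Fin n → Fin n → F))
  have h1 : (x : Set (Matrix (Fin n) (Fin n) F)).ncard = 2 ^ k := by
    have := Module.natCard_eq_pow_finrank (K := ZMod 2) (V := x)
    rwa [hx, Nat.card_zmod] at this
  have h2 : (y : Set (Matrix (Fin n) (Fin n) F)).ncard = 2 ^ (k + 1) := by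
    have := Module.natCard_eq_pow_finrank (K := ZMod 2) (V := y)
    rwa [hy, Nat.card_zmod] at this
  rw [Set.ncard_sdiff hxy, h1, h2, pow_succ]
  omega

theorem exists_graphProjection [Finite F] {k s : ℕ} (hn : 2 ^ (r + 1) ≤ n)
    (hks : k + (s + 2) = r + 1) (x : Face F r n) (hx : Module.finrank (ZMod 2) x.1 = k)
    (R C : Submodule F (Fin n → F)) (hR : Module.finrank F R = 2 ^ (r + 1) - 2 ^ (s + 2))
    (hC : Module.finrank F C = 2 ^ (r + 1) - 2 ^ (s + 2)) (c₁ : ℝ≥0) (hc₁ : 0 < c₁) :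
    ∃ c₂ : ℝ≥0, 0 < c₂ ∧ ∃ p : (Fin (2 ^ k - 1) → Vertex₁ F s) × Vertex₂ s n R C →
        {y : {y : Face F r n // x ≤ y} // ((lowRankPoset F r n).link x).rank y = 0},
      IsGraphProjection (((walk₁ F s c₁).tensorPow (2 ^ k - 1)).tensor (walk₂ s n R C c₂))
        ((lowRankPoset F r n).link x).skeletonGraph p := by
  classical
  have : Finite (Matrix (Fin n) (Fin n) F) := inferInstanceAs (Finite (Fin n → Fin n → F))
  obtain ⟨v, hv, hvx⟩ : ∃ v : Fin k → Matrix (Fin n) (Fin n) F, LinearIndependent (ZMod 2) v ∧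
      Submodule.span (ZMod 2) (Set.range v) = x.1 := by
    let b := Module.finBasisOfFinrankEq (ZMod 2) x.1 hx
    refine ⟨fun i => b i, b.linearIndependent.map' x.1.subtype x.1.ker_subtype, ?_⟩
    have := congrArg (Submodule.map x.1.subtype) b.span_eq
    rwa [Submodule.map_span, ← Set.range_comp, Submodule.map_top, Submodule.range_subtype] at this
  obtain ⟨E, hE⟩ : ∃ E, IsFrame (2 * (2 * 2 ^ s)) v E := by
    obtain ⟨W, hW, hxW⟩ := x.2
    have := hW.exists_isFrame_of_mem (d := s + 2) (by rw [Fintype.card_fin]; omega) hv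
      fun i => hxW (hvx ▸ Submodule.subset_span ⟨i, rfl⟩)
    rwa [pow_succ', pow_succ'] at this
  -- The `2 ^ k - 1` blocks of rank `2 ^ (s + 2)` add up to the prescribed dimension of `R` and `C`.
  have hrk : (∑ φ, E φ).rank = 2 ^ (r + 1) - 2 ^ (s + 2) := by
    rw [hE.rank_sum_univ, Fintype.card_fin, ← hks, Nat.sub_mul, one_mul, pow_add 2 k, pow_add 2 s]
    ring_nf
  obtain ⟨A, hAinj, hAhalf, hAsurj, hAadj⟩ := hE.exists_encoding (s := s) (N := 2 ^ k - 1)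
    (hR.trans hrk.symm) (hC.trans hrk.symm) (by rw [Fintype.card_fin])
  have hAsum : Function.Injective fun a => ∑ φ, A a φ := fun a b hab =>
    hAinj (IsHalf.eq_of_sum_eq hE (hAhalf a) (hAhalf b) hab)
  have hface a := ((hAhalf a).isFrame hE).span_optionCons hn hks hvx
  let p : (Fin (2 ^ k - 1) → Vertex₁ F s) × Vertex₂ s n R C →
      {y : {y : Face F r n // x ≤ y} // ((lowRankPoset F r n).link x).rank y = 0} :=
    fun a => ⟨⟨⟨_, (hface a).1⟩, (le_sup_left : x.1 ≤ _)⟩,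
      (link_rank_eq_iff hx _ 0).mpr (hface a).2.1⟩
  have hfin (y : {y : {y : Face F r n // x ≤ y} // ((lowRankPoset F r n).link x).rank y = 0}) :
      Module.finrank (ZMod 2) y.1.1.1 = k + 1 := (link_rank_eq_iff hx _ 0).mp y.2
  have hp (a) (y : {y : {y : Face F r n // x ≤ y} //
      ((lowRankPoset F r n).link x).rank y = 0}) :
      p a = y ↔ ∑ φ, A a φ ∈ (y.1.1.1 : Set (Matrix (Fin n) (Fin n) F)) \ x.1 := by
    constructor
    · rintro rfl
      exact ⟨Submodule.mem_sup_right (Submodule.mem_span_singleton_self _), (hface a).2.2⟩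
    · intro h
      refine Subtype.ext (Subtype.ext (Subtype.ext ?_))
      refine Submodule.eq_of_le_of_finrank_eq (sup_le y.1.2 ?_) ?_
      · rw [Submodule.span_singleton_le_iff_mem]
        exact h.1
      · rw [hfin y]
        exact (hface a).2.1
  -- Every vector of `y` outside `x` extends the frame, hence is the sum of a half family;
  -- injectivity of the sum then gives the fibre size.
  have himg (y : {y : {y : Face F r n // x ≤ y} //
      ((lowRankPoset F r n).link x).rank y = 0}) :
      (fun a => ∑ φ, A a φ) '' (p ⁻¹' {y}) =
        (y.1.1.1 : Set (Matrix (Fin n) (Fin n) F)) \ x.1 := by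
    ext m
    constructor
    · rintro ⟨a, ha, rfl⟩
      exact (hp a y).mp ha
    · intro hm
      obtain ⟨E', hE'⟩ := exists_isFrame_optionCons hks hv hvx y.1.2 hm.1 hm.2
      obtain ⟨hB, rfl⟩ := hE.isHalf hE'
      obtain ⟨a, ha⟩ := hAsurj _ hB
      refine ⟨a, (hp a y).mpr ?_, ?_⟩
      · rw [ha]; exact hm
      · beta_reduce
        rw [ha]
  have hcard (y) : (p ⁻¹' {y}).ncard = 2 ^ k := by
    rw [← Set.ncard_image_of_injective _ hAsum, himg, ncard_sdiff y.1.2 hx (hfin y)]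
  have hsurj : Function.Surjective p := by
    intro y
    have : (p ⁻¹' {y}).Nonempty := by
      rw [← Set.ncard_pos, hcard]
      positivity
    exact this
  have hadj (c₂ : ℝ≥0) (a b) :
      (((walk₁ F s c₁).tensorPow (2 ^ k - 1)).tensor (walk₂ s n R C c₂)).Adj a b ↔
        ((lowRankPoset F r n).link x).skeletonGraph.Adj (p a) (p b) := by
    rw [hAadj]
    constructor
    · rintro ⟨L₁, L₂, L₃, hL, ha, hb⟩
      obtain ⟨E', hE'⟩ := hL.exists_isFrame hE
      have ha' : ∑ φ, (L₁ φ + L₂ φ) = ∑ φ, A a φ := by rw [ha]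
      have hb' : ∑ φ, (L₁ φ + L₃ φ) = ∑ φ, A b φ := by rw [hb]
      rw [ha', hb'] at hE'
      obtain ⟨h1, h2, h3⟩ := hE'.span_optionCons_optionCons hn hks hvx
      let z : {y : Face F r n // x ≤ y} :=
        ⟨⟨_, h1⟩, (le_sup_left.trans le_sup_left : x.1 ≤ _)⟩
      have hlt (y : {y : {y : Face F r n // x ≤ y} // ((lowRankPoset F r n).link x).rank y = 0})
          (hy : y.1.1.1 ≤ z.1.1) : y.1 < z := by
        refine lt_of_le_of_ne hy fun h => ?_
        have h4 := hfin y
        rw [h] at h4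
        have : k + 2 = k + 1 := h2.symm.trans h4
        omega
      refine ⟨fun h => h3 ?_, z, (link_rank_eq_iff hx z 1).mpr h2, hlt _ le_sup_left, hlt _ ?_⟩
      · exact (((hp b (p a)).mp h.symm).1 :)
      · exact sup_le (le_sup_left.trans le_sup_left) le_sup_right
    · rintro ⟨hne, z, -, haz, hbz⟩
      have ha := (hp a _).mp rfl
      have hb := (hp b _).mp rfl
      obtain ⟨E', hE'⟩ := exists_isFrame_optionCons_optionCons hks hv hvx z.2
        (haz.le ha.1) ha.2 (hbz.le hb.1) fun h => hne ((hp b (p a)).mpr ⟨h, hb.2⟩).symm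
      exact hE.exists_isQuarter (hAhalf a) (hAhalf b) hE'
  obtain ⟨w, hw, hwz⟩ : ∃ w : ℝ≥0, 0 < w ∧ ∀ z, ((lowRankPoset F r n).link x).rank z = 1 →
      ((lowRankPoset F r n).link x).weight z = w := by
    by_cases h : ∃ z, ((lowRankPoset F r n).link x).rank z = 1
    · obtain ⟨z, hz⟩ := h
      refine ⟨_, link_weight_pos z, fun z' hz' => link_weight_eq ?_⟩
      exact ((link_rank_eq_iff hx z' 1).mp hz').trans ((link_rank_eq_iff hx z 1).mp hz).symm
    -- Without elements of rank one there are no edges, and any positive `w` serves.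
    · exact ⟨1, one_pos, fun z hz => absurd ⟨z, hz⟩ h⟩
  have hskel (y y') : ((lowRankPoset F r n).link x).skeletonGraph.weight y y' =
      if ((lowRankPoset F r n).link x).skeletonGraph.Adj y y' then w else 0 := by
    split_ifs with h
    · refine (if_pos h).trans ?_
      obtain ⟨hne, z, hz, hyz, hyz'⟩ := h
      -- Two distinct vertices have only one possible upper bound of rank one, namely their sum, so
      -- an edge weight is a single weight `w`.
      have huniq : {z' : {y : Face F r n // x ≤ y} |
          ((lowRankPoset F r n).link x).rank z' = 1 ∧ y.1 < z' ∧ y'.1 < z'} = {z} := by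
        have key (z' : {y : Face F r n // x ≤ y}) (h1 : ((lowRankPoset F r n).link x).rank z' = 1)
            (h2 : y.1 < z') (h3 : y'.1 < z') : y.1.1.1 ⊔ y'.1.1.1 = z'.1.1 := by
          have h4 : y.1.1.1 ⊔ y'.1.1.1 ≤ z'.1.1 := sup_le h2.le h3.le
          refine Submodule.eq_of_le_of_finrank_le h4 ?_
          rw [(link_rank_eq_iff hx z' 1).mp h1, ← hfin y]
          refine Submodule.finrank_lt_finrank_of_lt (lt_of_le_of_ne le_sup_left fun h5 => hne ?_)
          refine Subtype.ext (Subtype.ext (Subtype.ext ?_))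
          refine (Submodule.eq_of_le_of_finrank_eq (h5 ▸ le_sup_right) ?_).symm
          rw [hfin, hfin]
        ext z'
        constructor
        · rintro ⟨h1, h2, h3⟩
          exact Subtype.ext (Subtype.ext ((key z' h1 h2 h3).symm.trans (key z hz hyz hyz')))
        · rintro rfl
          exact ⟨hz, hyz, hyz'⟩
      have : ∑ᶠ z' ∈ {z' : {y : Face F r n // x ≤ y} |
          ((lowRankPoset F r n).link x).rank z' = 1 ∧ y.1 < z' ∧ y'.1 < z'},
          ((lowRankPoset F r n).link x).weight z' = w := by
        rw [huniq, finsum_mem_singleton, hwz z hz]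
      exact this
    · exact if_neg h
  have hpos : 0 < (2 ^ k * 2 ^ k : ℝ≥0) * c₁ ^ (2 ^ k - 1) := by positivity
  -- Above an edge there are `2 ^ k * 2 ^ k` pairs, each of weight `c₁ ^ (2 ^ k - 1) * c₂`, and
  -- these must add up to `w`.
  refine ⟨w / (2 ^ k * 2 ^ k * c₁ ^ (2 ^ k - 1)), div_pos hw hpos, p, hsurj, fun y y' => ?_⟩
  have hsum : ∀ a ∈ p ⁻¹' {y}, (∑ᶠ b ∈ p ⁻¹' {y'},
      (((walk₁ F s c₁).tensorPow (2 ^ k - 1)).tensor (walk₂ s n R C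
        (w / (2 ^ k * 2 ^ k * c₁ ^ (2 ^ k - 1))))).weight a b) =
      (2 ^ k : ℝ≥0) * if ((lowRankPoset F r n).link x).skeletonGraph.Adj y y' then
        c₁ ^ (2 ^ k - 1) * (w / (2 ^ k * 2 ^ k * c₁ ^ (2 ^ k - 1))) else 0 := by
    rintro a rfl
    have := finsum_mem_const_nnreal (p ⁻¹' {y'})
      (if ((lowRankPoset F r n).link x).skeletonGraph.Adj (p a) y' then
        c₁ ^ (2 ^ k - 1) * (w / (2 ^ k * 2 ^ k * c₁ ^ (2 ^ k - 1))) else 0)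
    rw [hcard, Nat.cast_pow, Nat.cast_ofNat] at this
    rw [← this]
    refine finsum_mem_congr rfl ?_
    rintro b rfl
    rw [weight_tensor_walk]
    simp only [hadj]
  rw [finsum_mem_congr rfl hsum, finsum_mem_const_nnreal, hcard, hskel, Nat.cast_pow,
    Nat.cast_ofNat]
  split_ifs
  · rw [← mul_assoc, ← mul_assoc, mul_div_cancel₀ _ hpos.ne']
  · simp

end Projection

end LowRank

theorem mainTheorem11 {F : Type*} [Field F] [Fintype F] [Algebra (ZMod 2) F]
    (r b n : ℕ) (hr : 1 ≤ r) (hb : 1 ≤ b) (hn : 2 ^ (r + 1) ≤ n)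
    (hF : Fintype.card F = 2 ^ b)
    (i : ℤ) (hi : -1 ≤ i) (hir : i ≤ (r : ℤ) - 2)
    (x : LowRank.Face F r n) (hx : (LowRank.lowRankPoset F r n).rank x = i)
    (R C : Submodule F (Fin n → F))
    (hR : Module.finrank F R = 2 ^ (r + 1) - 2 ^ ((r : ℤ) - i).toNat)
    (hC : Module.finrank F C = 2 ^ (r + 1) - 2 ^ ((r : ℤ) - i).toNat)
    (c₁ : NNReal) (hc₁ : 0 < c₁) :
    ∃ c₂ : NNReal, 0 < c₂ ∧
      ∃ p : (Fin (2 ^ (i + 1).toNat - 1) → LowRank.Vertex₁ F ((r : ℤ) - i - 2).toNat) ×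
            LowRank.Vertex₂ ((r : ℤ) - i - 2).toNat n R C →
          {y : {y : LowRank.Face F r n // x ≤ y} //
            ((LowRank.lowRankPoset F r n).link x).rank y = 0},
        LowRank.IsGraphProjection
          (((LowRank.walk₁ F ((r : ℤ) - i - 2).toNat c₁).tensorPow
              (2 ^ (i + 1).toNat - 1)).tensor
            (LowRank.walk₂ ((r : ℤ) - i - 2).toNat n R C c₂))
          ((LowRank.lowRankPoset F r n).link x).skeletonGraph p := by
  -- Here `s = r - i - 2`, and `x` has dimension `k = i + 1`.
  have hs : ((r : ℤ) - i).toNat = ((r : ℤ) - i - 2).toNat + 2 := by omega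
  rw [hs] at hR hC
  have hx' : (Module.finrank (ZMod 2) x.1 : ℤ) - 1 = i := hx
  exact LowRank.exists_graphProjection hn (by omega) x (by omega) R C hR hC c₁ hc₁
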